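/- Let $\alpha>0$, $0<\delta<\alpha$, $\kappa>0$ and $C\ge 1$ be real numbers and let $m\ge 1$ be an integer. There is a constant $K$, depending only on $\alpha,\delta,\kappa,m$ and $C$, with the following property. Let $1\le\lambda_1<\lambda_2<\cdots$ be real numbers tending to infinity and let $a_n\ge 0$ $(n\ge1)$ be real numbers such that the general Dirichlet series $A(s)=\sum_{n\ge1}a_n\lambda_n^{-s}$ converges in some right half-plane. Suppose that: (1) $A(s)$ can be analytically continued to the closed half-plane $\mathrm{Re}(s)\ge\alpha-\delta$ (that is, to a neighbourhood of each of its points), except for a pole of order exactly $m$ at $s=\alpha$; (2) for some $M_1,M_2\ge0$, $|(s-\alpha)^mA(s)|\le M_1\exp(|s|^{M_2})$ for all $s$ in the strip $\alpha-\delta\le\mathrm{Re}(s)\le\alpha$; (3) $|A(s)|\le C\,(1+|\mathrm{Im}(s)|)^{\kappa}\,\bigl(\log(3+|\mathrm{Im}(s)|)\bigr)^{m-1}$ for all $s$ with $\mathrm{Re}(s)=\alpha-\delta$. Then for all real $x\ge2$, $$\Bigl|\sum_{\lambda_n\le x}a_n-\mathop{\mathrm{Res}}_{s=\alpha}\Bigl[A(s)\frac{x^s}{s}\Bigr]\Bigr|\le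 K\,x^{\alpha-\frac{\delta}{\kappa+1}}(\log x)^{m-1}.$$ In particular $K$ does not depend on $M_1$, $M_2$, $(a_n)$ or $(\lambda_n)$. -/

import Mathlib

open Filter Topology

/-- The residue of `f` at `z₀`: the value, for all small `r > 0`, of `(2πi)⁻¹ ∮_{|z - z₀| = r} f(z) dz`.
If `f` is holomorphic in a punctured neighbourhood of `z₀`, this integral does not depend on the
small radius `r`, so the limit as `r → 0⁺` exists and is that common value. -/
noncomputable def residue (f : ℂ → ℂ) (z₀ : ℂ) : ℂ :=
  limUnder (𝓝[>] (0 : ℝ))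
    (fun r : ℝ => (2 * (Real.pi : ℂ) * Complex.I)⁻¹ * ∮ z in C(z₀, r), f z)

/-- The data of a general Dirichlet series `∑ a_n λ_n^{-s}` (indexed here from `n = 0`, with
`l n` in the role of `λ_n`): nonnegative coefficients `a n` and strictly increasing real numbers
`1 ≤ l 0 < l 1 < ⋯` that tend to infinity. -/
structure IsDirichletData (a l : ℕ → ℝ) : Prop where
  coeff_nonneg : ∀ n, 0 ≤ a n
  one_le : 1 ≤ l 0
  strictMono : StrictMono l
  tendsto_atTop : Tendsto l atTop atTop

/-- The partial sum `∑_{l n ≤ x} a n` (a finite sum whenever `l` tends to infinity). -/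
noncomputable def partialSum (a l : ℕ → ℝ) (x : ℝ) : ℝ :=
  ∑ᶠ n ∈ {n : ℕ | l n ≤ x}, a n

/-- The function `A` is the analytic continuation of the general Dirichlet series
`∑ a_n λ_n^{-s}` to the closed half-plane `Re s ≥ α - δ` aside from a pole of order `m` at
`s = α`; it has finite order in the strip `α - δ ≤ Re s ≤ α` and grows on the line
`Re s = α - δ` at most like `C (1 + |t|)^κ (log (3 + |t|))^{m-1}`. -/
structure StrongHypothesis (α δ κ : ℝ) (m : ℕ) (C : ℝ) (a l : ℕ → ℝ) (A : ℂ → ℂ) : Prop where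
  data : IsDirichletData a l
  /-- The series converges to `A` in some right half-plane. -/
  hasSum : ∃ σ₀ : ℝ, ∀ s : ℂ, σ₀ < s.re →
    HasSum (fun n => (a n : ℂ) * (l n : ℂ) ^ (-s)) (A s)
  /-- Holomorphic in a neighbourhood of each point of the closed half-plane other than `α`. -/
  analytic : AnalyticOnNhd ℂ A ({s : ℂ | α - δ ≤ s.re} \ {(α : ℂ)})
  meromorphicAt : MeromorphicAt A (α : ℂ)
  pole_order : meromorphicOrderAt A (α : ℂ) = ((-(m : ℤ) : ℤ) : WithTop ℤ)
  finite_order : ∃ M₁ M₂ : ℝ, 0 ≤ M₁ ∧ 0 ≤ M₂ ∧ ∀ s : ℂ, α - δ ≤ s.re → s.re ≤ α →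
    ‖(s - (α : ℂ)) ^ m * A s‖ ≤ M₁ * Real.exp (‖s‖ ^ M₂)
  growth : ∀ s : ℂ, s.re = α - δ →
    ‖A s‖ ≤ C * (1 + |s.im|) ^ κ * Real.log (3 + |s.im|) ^ (m - 1)

/-! Averaging the indicator of `[0, ∞)` `k` times over shifts of length `|η|` gives a step that lies
above the indicator when `η > 0` and below it when `η < 0`. As `a n ≥ 0`, the two smoothed sums trap
`∑_{l n ≤ x} a n`, and it suffices to compare each of them with the residue.

A smoothed sum is `(2πi)⁻¹ ∫ A(s) x ^ s E(s) ^ k / s ds` over `Re s = α + 1`, where `E = expAvg η`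
decays like `(1 + |η| |s|)⁻¹`. The line is moved to `Re s = α - δ` (`integral_line_eq`), which
leaves two errors. The new line contributes at most a constant times `x ^ (α - δ) |η| ^ (-κ) (log x)
^ (m - 1)` (`norm_integral_left_line_le`). Replacing `E ^ k` by `1` in the residue costs `|η| x ^ α
(log x) ^ (m - 1)`, as seen on a circle of radius comparable to `1 / log x`
(`norm_circleIntegral_sub_residue_le`). The choice `|η| = x ^ (-δ / (κ + 1))` makes the two equal.

For `K` to depend on the series only through `C`, the function `G(s) = (s - α) ^ m A(s)` must be
bounded near `α` uniformly over all admissible series. This comes from Phragmén–Lindelöf. Landau's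
theorem gives convergence for `Re s > α`, hence `|A(s)| ≤ |A(Re s)|` there. With the finite-order
hypothesis this makes `G(s) / s ^ N` bounded on `Re s ≥ α - δ` by some uncontrolled constant
(`norm_div_pow_le`). A second application, in the half-plane, replaces that constant by the bound on
the boundary line alone, where only `C` enters (`norm_le_growthConst_mul`). -/

/-! ### Smoothing kernels and smoothed step functions -/

section Kernel

open MeasureTheory Complex Set

/-- The average of `θ ↦ exp (η θ s)` over `[0, 1]`. -/
noncomputable def expAvg (η : ℝ) (s : ℂ) : ℂ := ∫ θ in (0 : ℝ)..1, exp (s * (η * θ : ℝ))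

lemma continuous_expAvg (η : ℝ) : Continuous (expAvg η) := by
  unfold expAvg
  apply intervalIntegral.continuous_parametric_intervalIntegral_of_continuous'
  fun_prop

lemma mul_expAvg (η : ℝ) (s : ℂ) : η * s * expAvg η s = exp (η * s) - 1 := by
  unfold expAvg
  rw [← intervalIntegral.integral_const_mul]
  have h : ∀ θ ∈ uIcc (0 : ℝ) 1, HasDerivAt (fun θ : ℝ => exp (s * (η * θ : ℝ)))
      (η * s * exp (s * (η * θ : ℝ))) θ := by
    intro θ _
    have h1 : HasDerivAt (fun θ : ℝ => s * ((η * θ : ℝ) : ℂ)) (s * (η : ℂ)) θ := by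
      have := ((hasDerivAt_id θ).const_mul η).ofReal_comp.const_mul s
      simpa using this
    convert h1.cexp using 1
    ring
  rw [intervalIntegral.integral_eq_sub_of_hasDerivAt h]
  · simp [mul_comm]
  · exact Continuous.intervalIntegrable (by fun_prop) _ _

/-- Away from `0` this is a quotient of entire functions; continuity makes the singularity at `0`
removable. -/
lemma differentiable_expAvg (η : ℝ) : Differentiable ℂ (expAvg η) := by
  rcases eq_or_ne η 0 with rfl | hη
  · have : expAvg 0 = fun _ => 1 := by ext s; simp [expAvg]
    rw [this]; fun_prop
  have hη' : (η : ℂ) ≠ 0 := by exact_mod_cast hη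
  have hd : ∀ s ≠ 0, DifferentiableAt ℂ (expAvg η) s := by
    intro s hs
    have he : expAvg η =ᶠ[𝓝 s] fun s => (exp (η * s) - 1) / (η * s) := by
      filter_upwards [isOpen_ne.mem_nhds hs] with z hz
      rw [← mul_expAvg, mul_div_cancel_left₀]
      exact mul_ne_zero hη' hz
    refine DifferentiableAt.congr_of_eventuallyEq ?_ he
    exact DifferentiableAt.div (by fun_prop) (by fun_prop) (mul_ne_zero hη' hs)
  intro s
  rcases eq_or_ne s 0 with rfl | hs
  · have := Complex.differentiableOn_compl_singleton_and_continuousAt_iff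
      (f := expAvg η) (s := univ) (c := 0) univ_mem
    exact (this.1 ⟨fun z hz => (hd z (by simpa using hz)).differentiableWithinAt,
      (continuous_expAvg η).continuousAt⟩).differentiableAt univ_mem
  · exact hd s hs

lemma norm_expAvg_le {η R : ℝ} {s : ℂ} (hη : |η| ≤ 1) (hs : 0 ≤ s.re) (hR : s.re ≤ R) :
    ‖expAvg η s‖ ≤ Real.exp R := by
  unfold expAvg
  have := intervalIntegral.norm_integral_le_of_norm_le_const (a := 0) (b := 1)
    (f := fun θ : ℝ => exp (s * (η * θ : ℝ))) (C := Real.exp R) ?_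
  · simpa using this
  · intro θ hθ
    rw [uIoc_of_le zero_le_one] at hθ
    rw [norm_exp, re_mul_ofReal, Real.exp_le_exp]
    have h1 : η * θ ≤ 1 := by
      calc η * θ ≤ |η| * θ := by gcongr; exacts [hθ.1.le, le_abs_self _]
        _ ≤ 1 * 1 := mul_le_mul hη hθ.2 hθ.1.le zero_le_one
        _ = 1 := one_mul 1
    nlinarith

/-- One average gains one power of `|η| ‖s‖`: the numerator in `mul_expAvg` stays bounded on the
strip. -/
lemma norm_expAvg_le_div {η R : ℝ} {s : ℂ} (hη : |η| ≤ 1) (hη0 : η ≠ 0) (hs : 0 < s.re)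
    (hR : s.re ≤ R) : ‖expAvg η s‖ ≤ 2 * Real.exp R / (|η| * ‖s‖) := by
  have hs0 : s ≠ 0 := by rintro rfl; simp at hs
  rw [le_div_iff₀ (by positivity)]
  have h1 : ‖expAvg η s‖ * (|η| * ‖s‖) = ‖exp (η * s) - 1‖ := by
    rw [← mul_expAvg, norm_mul, norm_mul, norm_real, Real.norm_eq_abs]; ring
  rw [h1]
  have h2 : ‖exp (η * s)‖ ≤ Real.exp R := by
    rw [norm_exp, re_ofReal_mul, Real.exp_le_exp]
    nlinarith [le_abs_self η]
  have h3 : 1 ≤ Real.exp R := Real.one_le_exp (hs.le.trans hR)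
  calc _ ≤ ‖exp (η * s)‖ + ‖(1 : ℂ)‖ := norm_sub_le _ _
    _ ≤ _ := by rw [norm_one]; linarith

/-- This measures the cost of smoothing near the pole; it rests on `|e ^ w - 1| ≤ |w| e ^ |w|` with
`w = η θ s`. -/
lemma norm_expAvg_sub_one_le {η R : ℝ} {s : ℂ} (hη : |η| ≤ 1) (hR : ‖s‖ ≤ R) :
    ‖expAvg η s - 1‖ ≤ |η| * (R * Real.exp R) := by
  have hR0 : 0 ≤ R := (norm_nonneg _).trans hR
  have h1 : expAvg η s - 1 = ∫ θ in (0 : ℝ)..1, (exp (s * (η * θ : ℝ)) - 1) := by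
    rw [intervalIntegral.integral_sub]
    · simp [expAvg]
    · exact Continuous.intervalIntegrable (by fun_prop) _ _
    · exact Continuous.intervalIntegrable (by fun_prop) _ _
  rw [h1]
  have := intervalIntegral.norm_integral_le_of_norm_le_const (a := 0) (b := 1)
    (f := fun θ : ℝ => exp (s * (η * θ : ℝ)) - 1) (C := |η| * (R * Real.exp R)) ?_
  · simpa using this
  · intro θ hθ
    rw [uIoc_of_le zero_le_one] at hθ
    have hn : ‖s * (η * θ : ℝ)‖ ≤ |η| * R := by
      rw [norm_mul, norm_real, Real.norm_eq_abs, abs_mul, abs_of_pos hθ.1]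
      calc ‖s‖ * (|η| * θ) ≤ R * (|η| * 1) :=
          mul_le_mul hR (by gcongr; exact hθ.2) (mul_nonneg (abs_nonneg _) hθ.1.le) hR0
        _ = _ := by ring
    have hn' : |η| * R ≤ R := by nlinarith
    have h2 := Complex.norm_exp_sub_sum_le_norm_mul_exp (s * (η * θ : ℝ)) 1
    simp only [Finset.range_one, Finset.sum_singleton, pow_zero, Nat.factorial_zero, Nat.cast_one,
      div_one, pow_one] at h2
    calc _ ≤ _ := h2
      _ ≤ (|η| * R) * Real.exp R := by gcongr; exact hn.trans hn'
      _ = _ := by ring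

/-- The indicator of `[0, ∞)`, averaged `j` times over the translates by `η θ`, `0 ≤ θ ≤ 1`. -/
noncomputable def smoothStep (η : ℝ) : ℕ → ℝ → ℝ
  | 0 => indicator (Ici 0) 1
  | j + 1 => fun v => ∫ θ in (0 : ℝ)..1, smoothStep η j (v + η * θ)

lemma intervalIntegrable_comp_affine {f : ℝ → ℝ} (hf : Monotone f) (v η a b : ℝ) :
    IntervalIntegrable (fun θ => f (v + η * θ)) volume a b := by
  rcases le_total 0 η with h | h
  · exact Monotone.intervalIntegrable fun x y hxy => hf (by nlinarith)
  · exact Antitone.intervalIntegrable fun x y hxy => hf (by nlinarith)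

lemma monotone_smoothStep (η : ℝ) (j : ℕ) : Monotone (smoothStep η j) := by
  induction j with
  | zero =>
    intro x y hxy
    simp only [smoothStep, indicator, mem_Ici, Pi.one_apply]
    split_ifs <;> linarith
  | succ j ih =>
    intro x y hxy
    simp only [smoothStep]
    exact intervalIntegral.integral_mono zero_le_one (intervalIntegrable_comp_affine ih _ _ _ _)
      (intervalIntegrable_comp_affine ih _ _ _ _) fun θ => ih (by linarith)

lemma smoothStep_mem_Icc (η : ℝ) (j : ℕ) (v : ℝ) : smoothStep η j v ∈ Icc (0 : ℝ) 1 := by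
  induction j generalizing v with
  | zero =>
    simp only [smoothStep, indicator, mem_Ici, Pi.one_apply]
    split_ifs <;> simp
  | succ j ih =>
    simp only [smoothStep]
    have hi := intervalIntegrable_comp_affine (monotone_smoothStep η j) v η 0 1
    constructor
    · exact intervalIntegral.integral_nonneg zero_le_one fun θ _ => (ih _).1
    · have := intervalIntegral.integral_mono zero_le_one hi
        (intervalIntegrable_const (c := (1 : ℝ))) fun θ => (ih _).2
      simpa using this

lemma smoothStep_eq_one {η : ℝ} (hη : 0 ≤ η) (j : ℕ) {v : ℝ} (hv : 0 ≤ v) :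
    smoothStep η j v = 1 := by
  induction j generalizing v with
  | zero => simp [smoothStep, hv]
  | succ j ih =>
    simp only [smoothStep]
    rw [intervalIntegral.integral_congr (g := fun _ => 1)]
    · simp
    · intro θ hθ
      rw [uIcc_of_le zero_le_one] at hθ
      exact ih (add_nonneg hv (mul_nonneg hη hθ.1))

lemma smoothStep_eq_zero {η : ℝ} (hη : η ≤ 0) (j : ℕ) {v : ℝ} (hv : v < 0) :
    smoothStep η j v = 0 := by
  induction j generalizing v with
  | zero => simp [smoothStep, hv]
  | succ j ih =>
    simp only [smoothStep]
    rw [intervalIntegral.integral_congr (g := fun _ => 0)]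
    · simp
    · intro θ hθ
      rw [uIcc_of_le zero_le_one] at hθ
      exact ih (by nlinarith [hθ.1])

lemma integral_indicator_Ici (y : ℝ) :
    ∫ u in (0 : ℝ)..y, indicator (Ici (0 : ℝ)) (1 : ℝ → ℝ) u = max y 0 := by
  rcases le_total 0 y with h | h
  · rw [max_eq_left h, intervalIntegral.integral_congr (g := fun _ => 1)]
    · simp
    · intro u hu
      rw [uIcc_of_le h] at hu
      simp [hu.1]
  · rw [max_eq_right h, intervalIntegral.integral_symm,
      intervalIntegral.integral_of_le h, integral_Ioc_eq_integral_Ioo,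
      setIntegral_congr_fun (g := fun _ => 0) measurableSet_Ioo]
    · simp
    · intro u hu
      have : ¬ (0 ≤ u) := not_le.2 hu.2
      simp [this]

/-- The single average is a difference of two ramps. It starts the induction in the inversion
formula, since the transform `1 / s ^ 2` of a ramp is absolutely integrable on vertical lines while
`1 / s` is not. -/
lemma mul_smoothStep_one (η v : ℝ) : η * smoothStep η 1 v = max (v + η) 0 - max v 0 := by
  simp only [smoothStep]
  have hm := monotone_smoothStep 0 0
  simp only [smoothStep] at hm
  have h := intervalIntegral.mul_integral_comp_add_mul (a := (0 : ℝ)) (b := 1)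
    (f := indicator (Ici (0 : ℝ)) (1 : ℝ → ℝ)) η v
  rw [h]
  simp only [mul_zero, add_zero, mul_one]
  rw [← integral_indicator_Ici, ← integral_indicator_Ici,
    intervalIntegral.integral_interval_sub_left]
  · exact hm.intervalIntegrable
  · exact hm.intervalIntegrable

end Kernel

/-! ### Inversion formula for the smoothed step -/

section Inversion

open MeasureTheory Complex Set

lemma norm_add_mul_I_sq (c t : ℝ) : ‖(c + t * I : ℂ)‖ ^ 2 = c ^ 2 + t ^ 2 := by
  rw [← normSq_eq_norm_sq, normSq_add_mul_I]

lemma integrable_of_norm_le_div_sq {c B : ℝ} (hc : 0 < c) {f : ℝ → ℂ} (hf : Continuous f)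
    (hB : ∀ t : ℝ, ‖f t‖ ≤ B / ‖(c + t * I : ℂ)‖ ^ 2) : Integrable f := by
  have hB0 : 0 ≤ B := by
    have := (norm_nonneg _).trans (hB 0)
    by_contra h
    have h2 : 0 < ‖((c : ℂ) + (0 : ℝ) * I)‖ ^ 2 := by rw [norm_add_mul_I_sq]; positivity
    exact absurd this (not_le.2 (div_neg_of_neg_of_pos (not_le.1 h) h2))
  refine Integrable.mono' (g := fun t => B * (1 + (c ^ 2)⁻¹) * (1 + t ^ 2)⁻¹)
    (integrable_inv_one_add_sq.const_mul _) hf.aestronglyMeasurable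
    (Eventually.of_forall fun t => (hB t).trans ?_)
  rw [norm_add_mul_I_sq, ← div_eq_mul_inv, div_le_div_iff₀ (by positivity) (by positivity)]
  have : (1 + (c ^ 2)⁻¹) * (c ^ 2 + t ^ 2) = c ^ 2 + t ^ 2 + 1 + t ^ 2 * (c ^ 2)⁻¹ := by
    field_simp; ring
  calc B * (1 + t ^ 2) ≤ B * ((1 + (c ^ 2)⁻¹) * (c ^ 2 + t ^ 2)) := by
        rw [this]
        refine mul_le_mul_of_nonneg_left ?_ hB0
        have : 0 ≤ t ^ 2 * (c ^ 2)⁻¹ := by positivity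
        nlinarith [sq_nonneg c]
    _ = _ := by ring

lemma add_mul_I_ne_zero {c : ℝ} (hc : 0 < c) (t : ℝ) : (c + t * I : ℂ) ≠ 0 := by
  intro h
  have := congrArg re h
  simp at this
  exact hc.ne' this

/-- Differentiating the Mellin transform `1 / s` of the indicator of `(0, 1]` shows that `-log t` on
`(0, 1]` has transform `1 / s ^ 2`. Mellin inversion at the point `e ^ (-v)` then gives the ramp. -/
lemma integral_exp_mul_div_sq {c : ℝ} (hc : 0 < c) (v : ℝ) :
    (1 / (2 * Real.pi) : ℂ) * ∫ t : ℝ, exp ((c + t * I) * v) / (c + t * I) ^ 2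
      = (max v 0 : ℝ) := by
  set f : ℝ → ℂ := indicator (Ioc 0 1) (fun _ => 1 : ℝ → ℂ) with hf
  set g : ℝ → ℂ := fun t => -(Real.log t • f t) with hg
  have key : ∀ s : ℂ, 0 < s.re → MellinConvergent g s ∧ mellin g s = 1 / s ^ 2 := by
    intro s hs
    have h := mellin_hasDerivAt_of_isBigO_rpow (f := f) (s := s) (a := s.re + 1) (b := 0)
      ?_ ?_ (by linarith) ?_ hs
    · have hd : HasDerivAt (mellin f) (-1 / s ^ 2) s := by
        have hs0 : s ≠ 0 := by rintro rfl; simp at hs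
        have h1 := (hasDerivAt_inv hs0)
        have he : mellin f =ᶠ[𝓝 s] fun z => z⁻¹ := by
          filter_upwards [(isOpen_lt continuous_const continuous_re).mem_nhds hs] with z hz
          rw [(hasMellin_one_Ioc hz).2, one_div]
        exact (h1.congr_of_eventuallyEq he).congr_deriv (by ring)
      refine ⟨?_, ?_⟩
      · have := h.1.neg
        unfold MellinConvergent
        refine this.congr_fun (fun t ht => ?_) measurableSet_Ioi
        simp [g]
      · have : mellin g s = - mellin (fun t => Real.log t • f t) s := by
          simp only [mellin, g, smul_neg, integral_neg]
        rw [this, h.2.unique hd]; ring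
    · exact ((integrable_indicator_iff measurableSet_Ioc).2
        (integrableOn_const (by simp))).locallyIntegrable.locallyIntegrableOn _
    · refine Asymptotics.IsBigO.of_bound 0 ?_
      filter_upwards [eventually_gt_atTop 1] with t ht
      have : t ∉ Ioc (0 : ℝ) 1 := fun h => absurd h.2 (not_le.2 ht)
      simp [f, this]
    · refine Asymptotics.IsBigO.of_bound 1 (Eventually.of_forall fun t => ?_)
      simp only [f, indicator]
      split_ifs <;> simp
  have hinv := mellinInv_mellin_eq c g (x := Real.exp (-v)) (Real.exp_pos _) (key c (by simpa)).1
    ?_ ?_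
  · have hgv : g (Real.exp (-v)) = (max v 0 : ℝ) := by
      simp only [g, f, indicator, mem_Ioc, Real.exp_pos, true_and, Real.exp_le_one_iff,
        Real.log_exp]
      rcases le_total 0 v with h | h
      · rw [if_pos (by linarith), max_eq_left h]; simp
      · rcases h.eq_or_lt with h | h
        · simp [h]
        · rw [if_neg (by linarith), max_eq_right h.le]; simp
    rw [← hgv, ← hinv, mellinInv, real_smul]
    congr 1
    · push_cast; rfl
    · congr 1
      ext t
      rw [(key (c + t * I) (by simpa)).2, cpow_def_of_ne_zero (by simp [Complex.exp_ne_zero]),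
        ← ofReal_log (Real.exp_pos _).le, Real.log_exp, smul_eq_mul]
      push_cast
      rw [mul_one_div]
      congr 2
      ring
  · have he : (fun t : ℝ => mellin g (c + t * I)) = fun t : ℝ => 1 / (c + t * I : ℂ) ^ 2 := by
      ext t; exact (key _ (by simpa)).2
    rw [VerticalIntegrable, he]
    refine integrable_of_norm_le_div_sq hc (B := 1) ?_ fun t => by simp
    exact continuous_const.div (by fun_prop) fun t => pow_ne_zero _ (add_mul_I_ne_zero hc t)
  · have he : g =ᶠ[𝓝 (Real.exp (-v))] fun t => ((max (-Real.log t) 0 : ℝ) : ℂ) := by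
      filter_upwards [isOpen_Ioi.mem_nhds (Real.exp_pos (-v))] with t ht
      rw [mem_Ioi] at ht
      simp only [g, f, indicator, mem_Ioc, ht, true_and]
      rcases le_or_gt t 1 with h | h
      · rw [if_pos h, max_eq_left (by linarith [Real.log_nonpos ht.le h])]; simp
      · rw [if_neg (not_le.2 h), max_eq_right (by linarith [Real.log_pos h])]; simp
    refine ContinuousAt.congr ?_ he.symm
    have := (Real.continuousAt_log (Real.exp_pos (-v)).ne')
    exact continuous_ofReal.continuousAt.comp (this.neg.max continuousAt_const)

/-- The Laplace transform of `smoothStep η j`, up to a reflection. -/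
noncomputable def smoothKernel (η : ℝ) (j : ℕ) (s : ℂ) : ℂ := expAvg η s ^ j / s

lemma norm_smoothKernel_le {η R : ℝ} {s : ℂ} (j : ℕ) (hη : |η| ≤ 1) (hη0 : η ≠ 0) (hs : 0 < s.re)
    (hR : s.re ≤ R) :
    ‖smoothKernel η j s‖ ≤ (2 * Real.exp R / |η|) ^ j / ‖s‖ ^ (j + 1) := by
  have hs0 : 0 < ‖s‖ := norm_pos_iff.2 (by rintro rfl; simp at hs)
  rw [smoothKernel, norm_div, norm_pow]
  calc _ ≤ (2 * Real.exp R / (|η| * ‖s‖)) ^ j / ‖s‖ := by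
        gcongr; exact norm_expAvg_le_div hη hη0 hs hR
    _ = _ := by
      rw [← div_div (2 * Real.exp R), div_pow, div_div, ← pow_succ]

/-- One factor of `expAvg` is spent on decay, enough for integrability; the others are bounded
trivially. -/
lemma norm_smoothKernel_le_div_sq {η c : ℝ} (j : ℕ) (hη : |η| ≤ 1) (hη0 : η ≠ 0) (hc : 0 < c)
    (t : ℝ) : ‖smoothKernel η (j + 1) (c + t * I)‖ ≤
      (Real.exp c ^ j * (2 * Real.exp c / |η|)) / ‖(c + t * I : ℂ)‖ ^ 2 := by
  have hs : (c + t * I : ℂ).re = c := by simp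
  have hs0 : 0 < ‖(c + t * I : ℂ)‖ := norm_pos_iff.2 (add_mul_I_ne_zero hc t)
  rw [smoothKernel, norm_div, norm_pow, pow_succ]
  calc _ ≤ (Real.exp c ^ j * (2 * Real.exp c / (|η| * ‖(c + t * I : ℂ)‖))) /
      ‖(c + t * I : ℂ)‖ := by
        gcongr
        · exact norm_expAvg_le hη (by rw [hs]; exact hc.le) hs.le
        · exact norm_expAvg_le_div hη hη0 (by rw [hs]; exact hc) hs.le
    _ = _ := by
      have : |η| ≠ 0 := abs_ne_zero.2 hη0
      field_simp

lemma continuous_smoothKernel_line (η : ℝ) (j : ℕ) {c : ℝ} (hc : 0 < c) :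
    Continuous fun t : ℝ => smoothKernel η j (c + t * I) :=
  (((continuous_expAvg η).comp (by fun_prop)).pow j).div (by fun_prop)
    fun t => add_mul_I_ne_zero hc t

lemma norm_exp_line (c v t : ℝ) : ‖exp ((c + t * I) * v)‖ = Real.exp (c * v) := by
  rw [norm_exp]; simp

lemma integrable_exp_mul_smoothKernel {η c : ℝ} (j : ℕ) (hη : |η| ≤ 1) (hη0 : η ≠ 0) (hc : 0 < c)
    (v : ℝ) :
    Integrable fun t : ℝ => exp ((c + t * I) * v) * smoothKernel η (j + 1) (c + t * I) := by
  refine integrable_of_norm_le_div_sq hc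
    (B := Real.exp (c * v) * (Real.exp c ^ j * (2 * Real.exp c / |η|))) ?_ fun t => ?_
  · exact (by fun_prop : Continuous fun t : ℝ => exp ((c + t * I) * v)).mul
      (continuous_smoothKernel_line η _ hc)
  · rw [norm_mul, norm_exp_line, mul_div_assoc]
    gcongr
    exact norm_smoothKernel_le_div_sq j hη hη0 hc t

/-- Shifting `v` by `η θ` multiplies the integrand by `exp (s η θ)`. By Fubini, each further average
over `θ` therefore multiplies the kernel by `expAvg η s`. -/
lemma integral_exp_mul_smoothKernel {η c : ℝ} (j : ℕ) (hη : |η| ≤ 1) (hη0 : η ≠ 0) (hc : 0 < c)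
    (v : ℝ) :
    (1 / (2 * Real.pi) : ℂ) *
        ∫ t : ℝ, exp ((c + t * I) * v) * smoothKernel η (j + 1) (c + t * I)
      = smoothStep η (j + 1) v := by
  have hη' : (η : ℂ) ≠ 0 := by exact_mod_cast hη0
  induction j generalizing v with
  | zero =>
    have hint : ∀ v : ℝ, Integrable fun t : ℝ => exp ((c + t * I) * v) / (c + t * I) ^ 2 := by
      intro v
      refine integrable_of_norm_le_div_sq hc (B := Real.exp (c * v)) ?_ fun t => ?_
      · exact (by fun_prop : Continuous fun t : ℝ => exp ((c + t * I) * v)).div (by fun_prop)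
          fun t => pow_ne_zero _ (add_mul_I_ne_zero hc t)
      · rw [norm_div, norm_exp_line, norm_pow]
    have h1 := mul_smoothStep_one η v
    have h2 : (η : ℂ) * smoothStep η 1 v = ((max (v + η) 0 : ℝ) : ℂ) - ((max v 0 : ℝ) : ℂ) := by
      exact_mod_cast h1
    rw [← integral_exp_mul_div_sq hc, ← integral_exp_mul_div_sq hc, ← mul_sub,
      ← integral_sub (hint _) (hint _)] at h2
    apply mul_left_cancel₀ hη'
    rw [zero_add, h2, mul_left_comm, ← integral_const_mul]
    congr 2
    ext t
    have hs := add_mul_I_ne_zero hc t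
    have h3 := mul_expAvg η (c + t * I)
    have h4 : exp ((c + t * I) * ((v + η : ℝ) : ℂ)) =
        exp ((c + t * I) * v) * exp (η * (c + t * I)) := by
      rw [← exp_add]; congr 1; push_cast; ring
    rw [h4, smoothKernel, pow_one]
    field_simp
    rw [← sub_eq_iff_eq_add'.2 (eq_add_of_sub_eq' h3.symm)]
  | succ j ih =>
    have hdef : smoothStep η (j + 1 + 1) v
      = ∫ θ in (0 : ℝ)..1, smoothStep η (j + 1) (v + η * θ) := rfl
    have hcast : ((smoothStep η (j + 1 + 1) v : ℝ) : ℂ)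
      = ∫ θ in (0 : ℝ)..1, ((smoothStep η (j + 1) (v + η * θ) : ℝ) : ℂ) := by
      rw [hdef, intervalIntegral.integral_ofReal]
    rw [hcast]
    simp_rw [← ih]
    rw [intervalIntegral.integral_const_mul]
    congr 1
    rw [intervalIntegral_integral_swap]
    · congr 1
      ext t
      have : ∀ θ : ℝ, exp ((c + t * I) * ((v + η * θ : ℝ) : ℂ)) *
          smoothKernel η (j + 1) (c + t * I) = (exp ((c + t * I) * v) *
          smoothKernel η (j + 1) (c + t * I)) * exp ((c + t * I) * (η * θ : ℝ)) := by
        intro θ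
        rw [ofReal_add, mul_add, exp_add]; ring
      simp_rw [this]
      rw [intervalIntegral.integral_const_mul]
      simp only [smoothKernel, expAvg, pow_succ]
      ring
    · have hg := (integrable_exp_mul_smoothKernel j hη hη0 hc v)
      have h1 : Integrable (fun _ : ℝ => Real.exp c) (volume.restrict (uIoc (0 : ℝ) 1)) := by
        simp [uIoc_of_le]
      refine (h1.mul_prod hg.norm).mono' ?_ ?_
      · apply Continuous.aestronglyMeasurable
        exact (by fun_prop : Continuous fun p : ℝ × ℝ =>
          exp ((c + p.2 * I) * ((v + η * p.1 : ℝ) : ℂ))).mul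
          ((continuous_smoothKernel_line η _ hc).comp continuous_snd)
      · have : ∀ᵐ p : ℝ × ℝ ∂(volume.restrict (uIoc (0 : ℝ) 1)).prod volume,
            p.1 ∈ uIoc (0 : ℝ) 1 := by
          have := (Measure.quasiMeasurePreserving_fst
            (μ := volume.restrict (uIoc (0 : ℝ) 1)) (ν := (volume : Measure ℝ))).ae
            (ae_restrict_mem measurableSet_uIoc)
          exact this
        filter_upwards [this] with p hp
        rw [uIoc_of_le zero_le_one] at hp
        simp only [Function.uncurry, norm_mul, norm_exp_line]
        rw [← mul_assoc, ← Real.exp_add]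
        gcongr
        have h2 : η * p.1 ≤ 1 := by
          calc η * p.1 ≤ |η| * p.1 := mul_le_mul_of_nonneg_right (le_abs_self _) hp.1.le
            _ ≤ 1 * 1 := mul_le_mul hη hp.2 hp.1.le zero_le_one
            _ = 1 := one_mul 1
        nlinarith

end Inversion

/-! ### Residues on rectangles and shifting of vertical lines -/

section Rectangle

open MeasureTheory Complex Set

/-- The integral of `f` along the boundary of `[a, b] × [-T, T]`, counterclockwise. -/
noncomputable def rectIntegral (f : ℂ → ℂ) (a b T : ℝ) : ℂ :=
  (∫ x : ℝ in a..b, f (x + (-T : ℝ) * I)) - (∫ x : ℝ in a..b, f (x + T * I)) +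
    I * (∫ y : ℝ in (-T)..T, f (b + y * I)) - I * (∫ y : ℝ in (-T)..T, f (a + y * I))

variable {f g : ℂ → ℂ} {a b α T r : ℝ}

lemma rectIntegral_eq_zero (hab : a ≤ b) (hT : 0 ≤ T)
    (hf : DifferentiableOn ℂ f (Icc a b ×ℂ Icc (-T) T)) : rectIntegral f a b T = 0 := by
  have := integral_boundary_rect_eq_zero_of_differentiableOn f (a + (-T : ℝ) * I) (b + T * I)
  simp only [add_re, ofReal_re, mul_re, I_re, mul_zero, ofReal_im, I_im, mul_one, sub_self,
    add_zero, add_im, mul_im, zero_add, uIcc_of_le hab, uIcc_of_le (by linarith : -T ≤ T)] at this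
  exact this hf

lemma horizontal_ne {x y : ℝ} (hy : y ≠ 0) : (x + y * I : ℂ) ≠ α := by
  intro h; have := congrArg im h; simp at this; exact hy this

lemma vertical_ne {x y : ℝ} (hx : x ≠ α) : (x + y * I : ℂ) ≠ α := by
  intro h; have := congrArg re h; simp at this; exact hx this

/-- The pole lies off the boundary, so the value of the integrand at `α` is irrelevant. -/
lemma rectIntegral_congr (ha : a < α) (hb : α < b) (hT : 0 < T) (h : ∀ z ≠ (α : ℂ), f z = g z) :
    rectIntegral f a b T = rectIntegral g a b T := by
  have h1 : ∀ y : ℝ, y ≠ 0 → (fun x : ℝ => f (x + y * I)) = fun x : ℝ => g (x + y * I) :=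
    fun y hy => funext fun x => h _ (horizontal_ne hy)
  have h2 : ∀ x : ℝ, x ≠ α → (fun y : ℝ => f (x + y * I)) = fun y : ℝ => g (x + y * I) :=
    fun x hx => funext fun y => h _ (vertical_ne hx)
  unfold rectIntegral
  rw [h1 T hT.ne', h1 (-T) (neg_ne_zero.2 hT.ne'), h2 a ha.ne, h2 b hb.ne']

lemma rectIntegral_add (ha : a < α) (hb : α < b) (hT : 0 < T)
    (hf : ContinuousOn f (Icc a b ×ℂ Icc (-T) T \ {(α : ℂ)}))
    (hg : ContinuousOn g (Icc a b ×ℂ Icc (-T) T \ {(α : ℂ)})) :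
    rectIntegral (fun z => f z + g z) a b T = rectIntegral f a b T + rectIntegral g a b T := by
  have h1 : ∀ {f : ℂ → ℂ}, ContinuousOn f (Icc a b ×ℂ Icc (-T) T \ {(α : ℂ)}) → ∀ y : ℝ,
      y ≠ 0 → y ∈ Icc (-T) T → IntervalIntegrable (fun x : ℝ => f (x + y * I)) volume a b := by
    intro f hf y hy hyT
    refine (hf.comp (by fun_prop) fun x hx => ?_).intervalIntegrable
    rw [uIcc_of_le (ha.trans hb).le] at hx
    exact ⟨by simpa [mem_reProdIm] using ⟨hx, hyT⟩, horizontal_ne hy⟩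
  have h2 : ∀ {f : ℂ → ℂ}, ContinuousOn f (Icc a b ×ℂ Icc (-T) T \ {(α : ℂ)}) → ∀ x : ℝ,
      x ≠ α → x ∈ Icc a b → IntervalIntegrable (fun y : ℝ => f (x + y * I)) volume (-T) T := by
    intro f hf x hx hxab
    refine (hf.comp (by fun_prop) fun y hy => ?_).intervalIntegrable
    rw [uIcc_of_le (by linarith)] at hy
    exact ⟨by simpa [mem_reProdIm] using ⟨hxab, hy⟩, vertical_ne hx⟩
  have hTm : T ∈ Icc (-T) T := ⟨by linarith, le_rfl⟩
  have hTm' : -T ∈ Icc (-T) T := ⟨le_rfl, by linarith⟩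
  have ham : a ∈ Icc a b := ⟨le_rfl, by linarith⟩
  have hbm : b ∈ Icc a b := ⟨by linarith, le_rfl⟩
  unfold rectIntegral
  rw [intervalIntegral.integral_add (h1 hf _ hT.ne' hTm) (h1 hg _ hT.ne' hTm),
    intervalIntegral.integral_add (h1 hf _ (neg_ne_zero.2 hT.ne') hTm')
      (h1 hg _ (neg_ne_zero.2 hT.ne') hTm'),
    intervalIntegral.integral_add (h2 hf _ ha.ne ham) (h2 hg _ ha.ne ham),
    intervalIntegral.integral_add (h2 hf _ hb.ne' hbm) (h2 hg _ hb.ne' hbm)]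
  ring

lemma integral_horizontal {F : ℂ → ℂ} {y : ℝ} (hab : a ≤ b)
    (hF : ∀ x ∈ Icc a b, HasDerivAt F (f (x + y * I)) (x + y * I))
    (hf : ContinuousOn (fun x : ℝ => f (x + y * I)) (Icc a b)) :
    ∫ x : ℝ in a..b, f (x + y * I) = F (b + y * I) - F (a + y * I) := by
  refine intervalIntegral.integral_eq_sub_of_hasDerivAt (f := fun x : ℝ => F (x + y * I)) ?_ ?_
  · intro x hx
    rw [uIcc_of_le hab] at hx
    have h1 : HasDerivAt (fun x : ℝ => (x + y * I : ℂ)) 1 x :=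
      (ofRealCLM.hasDerivAt (x := x)).add_const _
    exact ((hF x hx).comp x h1).congr_deriv (mul_one _)
  · exact ContinuousOn.intervalIntegrable (by rwa [uIcc_of_le hab])

lemma integral_vertical {F : ℂ → ℂ} {x : ℝ} (hab : a ≤ b)
    (hF : ∀ y ∈ Icc a b, HasDerivAt F (f (x + y * I)) (x + y * I))
    (hf : ContinuousOn (fun y : ℝ => f (x + y * I)) (Icc a b)) :
    I * ∫ y : ℝ in a..b, f (x + y * I) = F (x + b * I) - F (x + a * I) := by
  rw [← intervalIntegral.integral_const_mul]
  refine intervalIntegral.integral_eq_sub_of_hasDerivAt (f := fun y : ℝ => F (x + y * I)) ?_ ?_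
  · intro y hy
    rw [uIcc_of_le hab] at hy
    have h1 : HasDerivAt (fun y : ℝ => (x + y * I : ℂ)) I y := by
      simpa using ((ofRealCLM.hasDerivAt (x := y)).mul_const I).const_add (x : ℂ)
    exact ((hF y hy).comp y h1).congr_deriv (mul_comm _ _)
  · exact (ContinuousOn.intervalIntegrable (by rwa [uIcc_of_le hab])).const_mul I

lemma rectIntegral_pow_inv (ha : a < α) (hb : α < b) (hT : 0 < T) (n : ℕ) :
    rectIntegral (fun z => ((z - α) ^ (n + 2))⁻¹) a b T = 0 := by
  have hF : ∀ z : ℂ, z ≠ α → HasDerivAt (fun z : ℂ => -((n + 1 : ℂ)⁻¹ * ((z - α) ^ (n + 1))⁻¹))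
      (((z - α) ^ (n + 2))⁻¹) z := by
    intro z hz
    have hz' : z - α ≠ 0 := sub_ne_zero.2 hz
    have hn : (n + 1 : ℂ) ≠ 0 := by exact_mod_cast n.succ_ne_zero
    have h1 : HasDerivAt (fun z : ℂ => (z - α) ^ (n + 1)) ((n + 1 : ℂ) * (z - α) ^ n) z := by
      exact (((hasDerivAt_id z).sub_const (α : ℂ)).pow (n + 1)).congr_deriv (by simp)
    refine ((h1.inv (pow_ne_zero _ hz')).const_mul (n + 1 : ℂ)⁻¹).neg.congr_deriv ?_
    field_simp
    ring
  have hc : ∀ (h : ℝ → ℂ) (s : Set ℝ), Continuous h → (∀ x, h x ≠ α) →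
      ContinuousOn (fun x => ((h x - α) ^ (n + 2))⁻¹) s := fun h s hh hne =>
    (((hh.sub continuous_const).pow _).inv₀ fun x =>
      pow_ne_zero _ (sub_ne_zero.2 (hne x))).continuousOn
  have hab := (ha.trans hb).le
  have hTT : -T ≤ T := by linarith
  have hT' : -T ≠ 0 := neg_ne_zero.2 hT.ne'
  unfold rectIntegral
  rw [integral_horizontal (f := fun z => ((z - α) ^ (n + 2))⁻¹) hab
      (fun x _ => hF _ (horizontal_ne hT')) (hc _ _ (by fun_prop) fun x => horizontal_ne hT'),
    integral_horizontal (f := fun z => ((z - α) ^ (n + 2))⁻¹) hab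
      (fun x _ => hF _ (horizontal_ne hT.ne')) (hc _ _ (by fun_prop) fun x => horizontal_ne hT.ne'),
    integral_vertical (f := fun z => ((z - α) ^ (n + 2))⁻¹) hTT
      (fun x _ => hF _ (vertical_ne ha.ne)) (hc _ _ (by fun_prop) fun x => vertical_ne ha.ne),
    integral_vertical (f := fun z => ((z - α) ^ (n + 2))⁻¹) hTT
      (fun x _ => hF _ (vertical_ne hb.ne')) (hc _ _ (by fun_prop) fun x => vertical_ne hb.ne')]
  ring

lemma log_sub_log_neg {w : ℂ} (hw : 0 < w.im) : log w - log (-w) = Real.pi * I := by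
  simp only [log, norm_neg, arg_neg_eq_arg_sub_pi_of_im_pos hw]
  push_cast
  ring

/-- No single branch of the logarithm serves the whole boundary. On the left side `log (α - z)` is
the primitive, on the other sides `log (z - α)`; passing between them at each left corner
contributes `π i`. -/
lemma rectIntegral_inv (ha : a < α) (hb : α < b) (hT : 0 < T) :
    rectIntegral (fun z => (z - α)⁻¹) a b T = 2 * Real.pi * I := by
  have hF : ∀ z : ℂ, z - α ∈ slitPlane → HasDerivAt (fun z : ℂ => log (z - α)) ((z - α)⁻¹) z := by
    intro z hz
    simpa using ((hasDerivAt_id z).sub_const (α : ℂ)).clog hz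
  have hF' : ∀ z : ℂ, α - z ∈ slitPlane → HasDerivAt (fun z : ℂ => log (α - z)) ((z - α)⁻¹) z := by
    intro z hz
    have := ((hasDerivAt_id z).const_sub (α : ℂ)).clog hz
    refine this.congr_deriv ?_
    rw [← neg_sub (α : ℂ) z, inv_neg, id, neg_div, one_div]
  have hc : ∀ (h : ℝ → ℂ) (s : Set ℝ), Continuous h → (∀ x, h x ≠ α) →
      ContinuousOn (fun x => (h x - α)⁻¹) s := fun h s hh hne =>
    ((hh.sub continuous_const).inv₀ fun x => (sub_ne_zero.2 (hne x))).continuousOn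
  have hab := (ha.trans hb).le
  have hTT : -T ≤ T := by linarith
  have hT' : -T ≠ 0 := neg_ne_zero.2 hT.ne'
  have hh : ∀ x y : ℝ, y ≠ 0 → (x + y * I : ℂ) - α ∈ slitPlane := fun x y hy => by
    rw [mem_slitPlane_iff]; right; simpa using hy
  unfold rectIntegral
  rw [integral_horizontal (f := fun z => (z - α)⁻¹) hab
      (fun x _ => hF _ (hh x _ hT')) (hc _ _ (by fun_prop) fun x => horizontal_ne hT'),
    integral_horizontal (f := fun z => (z - α)⁻¹) hab
      (fun x _ => hF _ (hh x _ hT.ne')) (hc _ _ (by fun_prop) fun x => horizontal_ne hT.ne'),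
    integral_vertical (f := fun z => (z - α)⁻¹) hTT
      (fun x _ => hF' _ (by rw [mem_slitPlane_iff]; left; simpa using ha))
      (hc _ _ (by fun_prop) fun x => vertical_ne ha.ne),
    integral_vertical (f := fun z => (z - α)⁻¹) hTT
      (fun x _ => hF _ (by rw [mem_slitPlane_iff]; left; simpa using hb))
      (hc _ _ (by fun_prop) fun x => vertical_ne hb.ne')]
  have h1 := log_sub_log_neg (w := (a + T * I : ℂ) - α) (by simpa using hT)
  have h2 := log_sub_log_neg (w := (α : ℂ) - (a + (-T : ℝ) * I)) (by simpa using hT)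
  rw [neg_sub] at h1 h2
  linear_combination h1 + h2

/-- The integral of `g z / (z - α) ^ m` around a rectangle equals that around a circle. -/
lemma rectIntegral_eq_circleIntegral (ha : a < α) (hb : α < b) (hT : 0 < T) (hr : 0 < r)
    (hball : Metric.closedBall (α : ℂ) r ⊆ Icc a b ×ℂ Icc (-T) T)
    (m : ℕ) (hg : DifferentiableOn ℂ g (Icc a b ×ℂ Icc (-T) T)) :
    rectIntegral (fun z => g z * ((z - α) ^ m)⁻¹) a b T
      = ∮ z in C(α, r), g z * ((z - α) ^ m)⁻¹ := by
  have hnhds : Icc a b ×ℂ Icc (-T) T ∈ 𝓝 (α : ℂ) :=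
    mem_of_superset (Metric.closedBall_mem_nhds _ hr) hball
  induction m generalizing g with
  | zero =>
    simp only [pow_zero, inv_one, mul_one]
    rw [rectIntegral_eq_zero (ha.trans hb).le hT.le hg, eq_comm]
    refine DiffContOnCl.circleIntegral_eq_zero hr.le ?_
    refine DifferentiableOn.diffContOnCl ?_
    rw [closure_ball _ hr.ne']
    exact hg.mono hball
  | succ m ih =>
    -- Writing `g z = g α + (z - α) * dslope g α z` peels off one pure power of `(z - α)⁻¹` and
    -- lowers the pole order of the rest, so only pure powers have to be integrated explicitly.
    have hd : DifferentiableOn ℂ (dslope g α) (Icc a b ×ℂ Icc (-T) T) :=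
      (Complex.differentiableOn_dslope hnhds).2 hg
    have hsplit : ∀ z : ℂ, z ≠ α → g z * ((z - α) ^ (m + 1))⁻¹
        = g α * ((z - α) ^ (m + 1))⁻¹ + dslope g α z * ((z - α) ^ m)⁻¹ := by
      intro z hz
      have hz' : z - α ≠ 0 := sub_ne_zero.2 hz
      have := sub_smul_dslope g α z
      rw [smul_eq_mul] at this
      rw [← sub_eq_iff_eq_add', ← sub_mul, ← this, pow_succ]
      field_simp
    have hcont : ∀ n : ℕ, ContinuousOn (fun z : ℂ => ((z - α) ^ n)⁻¹) {z | z ≠ α} := fun n =>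
      ((continuous_id.sub continuous_const).pow n).continuousOn.inv₀ fun z hz =>
        pow_ne_zero _ (sub_ne_zero.2 hz)
    have hsub : (Icc a b ×ℂ Icc (-T) T \ {(α : ℂ)}) ⊆ {z | z ≠ α} := fun z hz => hz.2
    have hsph : ∀ z ∈ Metric.sphere (α : ℂ) r, z ≠ α := fun z hz h => by
      rw [h, mem_sphere_iff_norm, sub_self, norm_zero] at hz; exact hr.ne hz
    rw [rectIntegral_congr ha hb hT hsplit, rectIntegral_add
      (f := fun z => g α * ((z - α) ^ (m + 1))⁻¹) (g := fun z => dslope g α z * ((z - α) ^ m)⁻¹)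
      ha hb hT (continuousOn_const.mul ((hcont _).mono hsub))
      ((hd.continuousOn.mono sdiff_subset).mul ((hcont _).mono hsub)), ih hd,
      circleIntegral.integral_congr hr.le fun z hz => hsplit z (hsph z hz),
      circleIntegral.integral_add]
    · congr 1
      rw [circleIntegral.integral_const_mul]
      have hm : rectIntegral (fun z => g α * ((z - α) ^ (m + 1))⁻¹) a b T
          = g α * rectIntegral (fun z => ((z - α) ^ (m + 1))⁻¹) a b T := by
        simp only [rectIntegral, intervalIntegral.integral_const_mul]; ring
      rw [hm]
      congr 1
      rcases m with _ | n
      · simp only [zero_add, pow_one]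
        rw [rectIntegral_inv ha hb hT, circleIntegral.integral_sub_center_inv _ hr.ne']
      · rw [rectIntegral_pow_inv ha hb hT]
        have := circleIntegral.integral_sub_zpow_of_ne (n := -((n + 2 : ℕ) : ℤ))
          (by omega) (α : ℂ) α r
        simp only [zpow_neg, zpow_natCast] at this
        exact this.symm
    · exact ContinuousOn.circleIntegrable hr.le (continuousOn_const.mul ((hcont _).mono hsph))
    · refine ContinuousOn.circleIntegrable hr.le (ContinuousOn.mul ?_ ((hcont _).mono hsph))
      exact hd.continuousOn.mono (Metric.sphere_subset_closedBall.trans hball)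

/-- Shifting a vertical line of integration across a pole. -/
lemma integral_line_sub_integral_line {B : ℝ} (hr : 0 < r) (ha : a + r ≤ α) (hb : α + r ≤ b)
    (m : ℕ) (hg : DifferentiableOn ℂ g (re ⁻¹' Icc a b))
    (hB : ∀ z : ℂ, z.re ∈ Icc a b → 1 ≤ |z.im| → ‖g z * ((z - α) ^ m)⁻¹‖ ≤ B / |z.im|)
    (hia : Integrable fun y : ℝ => g (a + y * I) * ((a + y * I - α : ℂ) ^ m)⁻¹)
    (hib : Integrable fun y : ℝ => g (b + y * I) * ((b + y * I - α : ℂ) ^ m)⁻¹) :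
    I * (∫ y : ℝ, g (b + y * I) * ((b + y * I - α : ℂ) ^ m)⁻¹) -
      I * (∫ y : ℝ, g (a + y * I) * ((a + y * I - α : ℂ) ^ m)⁻¹)
      = ∮ z in C(α, r), g z * ((z - α) ^ m)⁻¹ := by
  have hab : a ≤ b := by linarith
  set f : ℂ → ℂ := fun z => g z * ((z - α) ^ m)⁻¹ with hf
  have hhor : ∀ T : ℝ, 1 ≤ |T| → ‖∫ x : ℝ in a..b, f (x + T * I)‖ ≤ B / |T| * |b - a| := by
    intro T hT
    refine intervalIntegral.norm_integral_le_of_norm_le_const fun x hx => ?_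
    rw [uIoc_of_le hab] at hx
    have := hB (x + T * I) (by simpa using ⟨hx.1.le, hx.2⟩) (by simpa using hT)
    rwa [add_im, ofReal_im, mul_I_im, ofReal_re, zero_add] at this
  have hlim0 : Tendsto (fun T : ℝ => B / |T| * |b - a|) atTop (𝓝 0) := by
    have : Tendsto (fun T : ℝ => B / |T|) atTop (𝓝 0) :=
      tendsto_const_nhds.div_atTop tendsto_abs_atTop_atTop
    simpa using this.mul_const |b - a|
  have h1 : Tendsto (fun T : ℝ => ∫ x : ℝ in a..b, f (x + T * I)) atTop (𝓝 0) := by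
    refine squeeze_zero_norm' ?_ hlim0
    filter_upwards [eventually_ge_atTop 1] with T hT
    exact hhor T (hT.trans (le_abs_self T))
  have h2 : Tendsto (fun T : ℝ => ∫ x : ℝ in a..b, f (x + (-T : ℝ) * I)) atTop (𝓝 0) := by
    refine squeeze_zero_norm' ?_ hlim0
    filter_upwards [eventually_ge_atTop 1] with T hT
    have := hhor (-T) (by rw [abs_neg]; exact hT.trans (le_abs_self T))
    rwa [abs_neg] at this
  have h3 := intervalIntegral_tendsto_integral hia tendsto_neg_atTop_atBot tendsto_id
  have h4 := intervalIntegral_tendsto_integral hib tendsto_neg_atTop_atBot tendsto_id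
  have hlim := ((h2.sub h1).add (h4.const_mul I)).sub (h3.const_mul I)
  rw [sub_zero, zero_add] at hlim
  refine tendsto_nhds_unique hlim (tendsto_const_nhds.congr' ?_)
  filter_upwards [eventually_ge_atTop r] with T hT
  refine (rectIntegral_eq_circleIntegral (by linarith) (by linarith) (hr.trans_le hT) hr ?_ m
    (hg.mono fun z hz => hz.1)).symm
  intro z hz
  rw [mem_closedBall_iff_norm] at hz
  have hre := (abs_re_le_norm _).trans hz
  have him := (abs_im_le_norm _).trans hz
  rw [sub_re, ofReal_re, abs_le] at hre
  rw [sub_im, ofReal_im, sub_zero, abs_le] at him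
  exact ⟨⟨by linarith [hre.1], by linarith [hre.2]⟩, ⟨by linarith [him.1], by linarith [him.2]⟩⟩

end Rectangle

/-! ### Landau's theorem for nonnegative coefficients -/

section Landau

open Complex Set

/-- **Landau's theorem**: a function given near `0` by `∑ b i * exp (L i * z)` with `b, L ≥ 0` that
is holomorphic in `|z| < R` is the limit of this series for all `0 ≤ z < R`. -/
lemma summable_exp_of_differentiableOn {b L : ℕ → ℝ} (hb : ∀ i, 0 ≤ b i) (hL : ∀ i, 0 ≤ L i)
    {f : ℂ → ℂ} {ρ R r : ℝ} (hρ : 0 < ρ) (hsum : Summable fun i => b i * Real.exp (L i * ρ))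
    (hf : ∀ z : ℂ, ‖z‖ < ρ → HasSum (fun i => (b i : ℂ) * exp (L i * z)) (f z))
    (hd : DifferentiableOn ℂ f (Metric.ball 0 R)) (hr0 : 0 ≤ r) (hr : r < R) :
    Summable fun i => b i * Real.exp (L i * r) := by
  have hexp : ∀ i (y : ℝ), HasSum (fun k : ℕ => b i * ((L i * y) ^ k / k.factorial))
      (b i * Real.exp (L i * y)) := fun i y => by
    rw [Real.exp_eq_exp_ℝ]
    exact (NormedSpace.expSeries_div_hasSum_exp (L i * y)).mul_left _
  have hexpC : ∀ i (y : ℂ), HasSum (fun k : ℕ => (b i : ℂ) * ((L i * y) ^ k / k.factorial))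
      (b i * exp (L i * y)) := fun i y => by
    rw [Complex.exp_eq_exp_ℂ]
    exact (NormedSpace.expSeries_div_hasSum_exp ((L i : ℂ) * y)).mul_left _
  have hs : ∀ y : ℝ, 0 ≤ y → y ≤ ρ →
      Summable fun p : ℕ × ℕ => b p.1 * ((L p.1 * y) ^ p.2 / p.2.factorial) := by
    intro y hy hyρ
    rw [summable_prod_of_nonneg]
    · refine ⟨fun i => (hexp i y).summable, ?_⟩
      simp_rw [fun i => (hexp i y).tsum_eq]
      refine hsum.of_nonneg_of_le (fun i => mul_nonneg (hb i) (Real.exp_pos _).le) fun i => ?_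
      have := hL i; have := hb i
      gcongr
    · intro p
      have := hL p.1; have := hb p.1
      simp only [Pi.zero_apply]
      positivity
  -- These are the Taylor coefficients of `f` at `0`, found by expanding each exponential and
  -- exchanging the sums. They are nonnegative.
  set q : ℕ → ℝ := fun k => ∑' i, b i * L i ^ k / k.factorial with hq
  have hqs : ∀ k, Summable fun i => b i * L i ^ k / k.factorial := by
    intro k
    have h1 := ((Equiv.prodComm ℕ ℕ).summable_iff.2 (hs ρ hρ.le le_rfl)).prod_factor k
    have h2 := h1.mul_right ((ρ ^ k)⁻¹)
    refine h2.congr fun i => ?_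
    have : ρ ^ k ≠ 0 := (pow_pos hρ k).ne'
    simp only [Function.comp, Equiv.prodComm_apply, Prod.swap, mul_pow]
    field_simp
  have hlocal : HasFPowerSeriesAt f (FormalMultilinearSeries.ofScalars ℂ fun k => (q k : ℂ)) 0 := by
    rw [hasFPowerSeriesAt_iff]
    filter_upwards [Metric.ball_mem_nhds (0 : ℂ) hρ] with z hz
    rw [mem_ball_zero_iff] at hz
    have hsz : Summable fun p : ℕ × ℕ => (b p.1 : ℂ) * ((L p.1 * z) ^ p.2 / p.2.factorial) := by
      refine Summable.of_norm ((hs ‖z‖ (norm_nonneg _) hz.le).congr fun p => ?_)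
      simp [abs_of_nonneg (hb p.1), abs_of_nonneg (hL p.1)]
    have h1 := hsz.hasSum.prod_fiberwise fun i => hexpC i z
    have h2 := h1.unique (hf z hz)
    have hsw := (Equiv.prodComm ℕ ℕ).hasSum_iff.2 hsz.hasSum
    rw [h2] at hsw
    rw [zero_add]
    refine hsw.prod_fiberwise fun k => ?_
    simp only [FormalMultilinearSeries.coeff_ofScalars, smul_eq_mul, Function.comp,
      Equiv.prodComm_apply, Prod.swap]
    have h3 : HasSum (fun i => ((b i * L i ^ k / k.factorial : ℝ) : ℂ)) (q k : ℂ) := by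
      exact_mod_cast (hqs k).hasSum
    refine (h3.mul_left (z ^ k)).congr_fun fun i => ?_
    push_cast
    ring
  obtain ⟨R', hR', hR'R⟩ := exists_between hr
  have hR'0 : 0 < R' := hr0.trans_lt hR'
  lift R' to NNReal using hR'0.le
  have hbig := DifferentiableOn.hasFPowerSeriesOnBall (R := R')
    (hd.mono (Metric.closedBall_subset_ball hR'R)) (by exact_mod_cast hR'0)
  rw [hbig.hasFPowerSeriesAt.eq_formalMultilinearSeries hlocal] at hbig
  have hrs := (hbig.hasSum (y := (r : ℂ)) (by
    rw [Metric.mem_eball, edist_zero_right, ← ofReal_norm, norm_real, Real.norm_of_nonneg hr0,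
      ENNReal.ofReal_lt_coe_iff]
    exacts [hR', hr0])).summable
  have hqr : Summable fun k => q k * r ^ k := by
    rw [← Complex.summable_ofReal]
    refine hrs.congr fun k => ?_
    rw [FormalMultilinearSeries.apply_eq_pow_smul_coeff, FormalMultilinearSeries.coeff_ofScalars]
    push_cast
    rw [smul_eq_mul, mul_comm]
  have h5 : ∀ k, Summable fun i => b i * L i ^ k / k.factorial * r ^ k :=
    fun k => (hqs k).mul_right _
  have h6 : ∀ k, ∑' i, b i * L i ^ k / k.factorial * r ^ k = q k * r ^ k :=
    fun k => tsum_mul_right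
  -- The Taylor series converges at `r` because `f` is holomorphic in a larger disc. All terms are
  -- nonnegative, so the double series converges, and summing over `k` first restores the
  -- exponentials.
  have hprod : Summable fun p : ℕ × ℕ => b p.2 * L p.2 ^ p.1 / p.1.factorial * r ^ p.1 := by
    refine (summable_prod_of_nonneg fun p => ?_).2 ⟨h5, hqr.congr fun k => (h6 k).symm⟩
    have := hL p.2; have := hb p.2
    simp only [Pi.zero_apply]
    positivity
  have hfin := ((Equiv.prodComm ℕ ℕ).summable_iff.2 hprod).prod
  refine hfin.congr fun i => ?_
  rw [← (hexp i r).tsum_eq]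
  refine tsum_congr fun k => ?_
  simp only [Function.comp, Equiv.prodComm_apply, Prod.swap, mul_pow]
  ring

end Landau

/-! ### Convergence and majorants to the right of the pole -/

section Growth

open Complex Set

lemma IsDirichletData.one_le_apply {a l : ℕ → ℝ} (h : IsDirichletData a l) (n : ℕ) : 1 ≤ l n :=
  h.one_le.trans (h.strictMono.monotone n.zero_le)

lemma IsDirichletData.log_nonneg {a l : ℕ → ℝ} (h : IsDirichletData a l) (n : ℕ) :
    0 ≤ Real.log (l n) := Real.log_nonneg (h.one_le_apply n)

lemma cpow_neg_eq_exp {x : ℝ} (hx : 0 < x) (s : ℂ) :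
    (x : ℂ) ^ (-s) = exp (Real.log x * -s) := by
  rw [cpow_def_of_ne_zero (by exact_mod_cast hx.ne'), ofReal_log hx.le]

namespace StrongHypothesis

variable {α δ κ C : ℝ} {m : ℕ} {a l : ℕ → ℝ} {A : ℂ → ℂ}

/-- The value of `A` at the pole is arbitrary, so the product is corrected there to the value of the
analytic factor. -/
lemma exists_analytic (h : StrongHypothesis α δ κ m C a l A) :
    ∃ G : ℂ → ℂ, AnalyticOnNhd ℂ G {s | α - δ ≤ s.re} ∧
      ∀ s ≠ (α : ℂ), G s = (s - α) ^ m * A s := by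
  obtain ⟨g, hg, -, hgA⟩ := (meromorphicOrderAt_eq_int_iff h.meromorphicAt).1 h.pole_order
  refine ⟨Function.update (fun s => (s - α) ^ m * A s) α (g α), fun s hs => ?_, fun s hs => by
    rw [Function.update_of_ne hs]⟩
  rcases eq_or_ne s α with rfl | hsα
  · refine hg.congr (eventuallyEq_nhds_of_eventuallyEq_nhdsNE ?_ (by simp))
    filter_upwards [hgA, self_mem_nhdsWithin] with z hz hzα
    have : z - α ≠ 0 := sub_ne_zero.2 hzα
    rw [Function.update_of_ne hzα, hz, zpow_neg, zpow_natCast, smul_eq_mul,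
      mul_inv_cancel_left₀ (pow_ne_zero _ this)]
  · refine AnalyticAt.congr (f := fun s => (s - α) ^ m * A s) ?_ ?_
    · exact ((analyticAt_id.sub analyticAt_const).pow m).mul (h.analytic s ⟨hs, hsα⟩)
    · filter_upwards [isOpen_ne.mem_nhds hsα] with z hz
      rw [Function.update_of_ne hz]

lemma summable_exp (h : StrongHypothesis α δ κ m C a l A) (hδ : 0 < δ) {σ : ℝ} (hσ : α < σ) :
    Summable fun n => a n * Real.exp (-(Real.log (l n) * σ)) := by
  obtain ⟨σ₀, hσ₀⟩ := h.hasSum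
  -- The centre lies far enough to the right for the series to converge on the unit disc around it
  -- and at `c - 1`. The disc of radius `c - α` contains `σ` and avoids the pole.
  set c := max (σ₀ + 2) (σ + 1) with hc
  have hc1 : σ₀ + 2 ≤ c := le_max_left _ _
  have hc2 : σ + 1 ≤ c := le_max_right _ _
  have hl : ∀ n, 0 < l n := fun n => zero_lt_one.trans_le (h.data.one_le_apply n)
  have hterm : ∀ n (z : ℂ), ((a n * Real.exp (-(Real.log (l n) * c)) : ℝ) : ℂ) *
      exp (Real.log (l n) * z) = a n * (l n : ℂ) ^ (-(c - z)) := by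
    intro n z
    rw [cpow_neg_eq_exp (hl n)]
    push_cast
    rw [mul_assoc, ← Complex.exp_add]
    congr 2
    ring
  have key := summable_exp_of_differentiableOn
    (b := fun n => a n * Real.exp (-(Real.log (l n) * c))) (L := fun n => Real.log (l n))
    (f := fun z => A (c - z)) (ρ := 1) (R := c - α) (r := c - σ)
    (fun n => mul_nonneg (h.data.coeff_nonneg n) (Real.exp_pos _).le) h.data.log_nonneg one_pos
    ?_ ?_ ?_ (by linarith) (by linarith)
  · refine key.congr fun n => ?_
    rw [mul_assoc, ← Real.exp_add]
    congr 2
    ring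
  · have := (hσ₀ (c - 1) (by simp; linarith)).summable
    rw [← Complex.summable_ofReal]
    refine this.congr fun n => ?_
    rw [← hterm n 1]
    push_cast
    rw [mul_one]
  · intro z hz
    have := hσ₀ (c - z) (by
      have := (re_le_norm z)
      simp; linarith)
    simpa only [hterm] using this
  · intro z hz
    rw [mem_ball_zero_iff] at hz
    have hzre := re_le_norm z
    have hre : α < ((c : ℂ) - z).re := by simp; linarith
    have hA := (h.analytic (c - z) ⟨by simp at hre ⊢; linarith, fun hh => by
      rw [mem_singleton_iff] at hh
      rw [hh, ofReal_re] at hre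
      exact lt_irrefl _ hre⟩).differentiableAt
    exact (hA.comp z (by fun_prop : DifferentiableAt ℂ (fun z : ℂ => (c : ℂ) - z) z)).differentiableWithinAt

lemma norm_term (h : StrongHypothesis α δ κ m C a l A) (n : ℕ) (s : ℂ) :
    ‖(a n : ℂ) * (l n : ℂ) ^ (-s)‖ = a n * Real.exp (-(Real.log (l n) * s.re)) := by
  rw [cpow_neg_eq_exp (zero_lt_one.trans_le (h.data.one_le_apply n)), norm_mul, norm_real,
    Real.norm_of_nonneg (h.data.coeff_nonneg n), norm_exp, re_ofReal_mul, neg_re, mul_neg]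

lemma norm_term_le (h : StrongHypothesis α δ κ m C a l A) (n : ℕ) {s : ℂ} {σ : ℝ}
    (hs : σ ≤ s.re) :
    ‖(a n : ℂ) * (l n : ℂ) ^ (-s)‖ ≤ a n * Real.exp (-(Real.log (l n) * σ)) := by
  have := h.data.coeff_nonneg n
  have := h.data.log_nonneg n
  rw [h.norm_term]
  gcongr

/-- The sum of the series is holomorphic wherever it converges locally uniformly, and the identity
theorem carries its equality with `A` from the far half-plane to all of `Re s > α`. -/
lemma hasSum_of_lt_re (h : StrongHypothesis α δ κ m C a l A) (hδ : 0 < δ) {s : ℂ}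
    (hs : α < s.re) : HasSum (fun n => (a n : ℂ) * (l n : ℂ) ^ (-s)) (A s) := by
  obtain ⟨σ, hσ, hσs⟩ := exists_between hs
  obtain ⟨σ₀, hσ₀⟩ := h.hasSum
  have hsum := h.summable_exp hδ hσ
  set U : Set ℂ := {s | σ < s.re} with hU
  have hUo : IsOpen U := isOpen_lt continuous_const continuous_re
  have hd : DifferentiableOn ℂ (fun s => ∑' n, (a n : ℂ) * (l n : ℂ) ^ (-s)) U := by
    refine differentiableOn_tsum_of_summable_norm hsum (fun n => ?_) hUo
      fun n z hz => h.norm_term_le n hz.le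
    have : (l n : ℂ) ≠ 0 := by
      exact_mod_cast (zero_lt_one.trans_le (h.data.one_le_apply n)).ne'
    intro z _
    exact ((differentiableAt_id.neg.const_cpow (Or.inl this)).const_mul _).differentiableWithinAt
  have hA : AnalyticOnNhd ℂ A U := fun z hz => h.analytic z ⟨by
      have : σ < z.re := hz
      simp only [mem_ofPred_eq]; linarith, fun hh => by
    rw [mem_singleton_iff] at hh
    have : σ < z.re := hz
    rw [hh, ofReal_re] at this
    linarith⟩
  have hpt : ((max σ σ₀ + 1 : ℝ) : ℂ) ∈ U := by
    have := le_max_left σ σ₀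
    simp only [hU, mem_ofPred_eq, ofReal_re]; linarith
  have heq := hA.eqOn_of_preconnected_of_eventuallyEq (hd.analyticOnNhd hUo)
    (convex_halfSpace_re_gt σ).isPreconnected hpt (by
      have hmem : {z : ℂ | σ₀ < z.re} ∈ 𝓝 ((max σ σ₀ + 1 : ℝ) : ℂ) := by
        refine (isOpen_lt continuous_const continuous_re).mem_nhds ?_
        have := le_max_right σ σ₀
        simp only [mem_ofPred_eq, ofReal_re]; linarith
      filter_upwards [hmem] with z hz
      exact (hσ₀ z hz).tsum_eq.symm)
  rw [heq hσs]
  exact (Summable.of_norm (hsum.of_nonneg_of_le (fun n => norm_nonneg _)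
    fun n => h.norm_term_le n hσs.le)).hasSum

/-- For `σ > α`, the value of the Dirichlet series at `σ` bounds it on `Re s ≥ σ`. -/
lemma norm_le_tsum (h : StrongHypothesis α δ κ m C a l A) (hδ : 0 < δ) {σ : ℝ} {s : ℂ}
    (hσ : α < σ) (hs : σ ≤ s.re) :
    ‖A s‖ ≤ ∑' n, a n * Real.exp (-(Real.log (l n) * σ)) := by
  rw [← (h.hasSum_of_lt_re hδ (hσ.trans_le hs)).tsum_eq]
  exact tsum_of_norm_bounded (h.summable_exp hδ hσ).hasSum fun n => h.norm_term_le n hs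

lemma norm_apply_ofReal (h : StrongHypothesis α δ κ m C a l A) (hδ : 0 < δ) {σ : ℝ}
    (hσ : α < σ) : ‖A σ‖ = ∑' n, a n * Real.exp (-(Real.log (l n) * σ)) := by
  have h1 : HasSum (fun n => ((a n * Real.exp (-(Real.log (l n) * σ)) : ℝ) : ℂ)) (A σ) := by
    refine (h.hasSum_of_lt_re hδ (s := σ) (by simpa)).congr_fun fun n => ?_
    rw [cpow_neg_eq_exp (zero_lt_one.trans_le (h.data.one_le_apply n))]
    push_cast
    rw [mul_neg]
  rw [← h1.tsum_eq, ← ofReal_tsum, norm_real, Real.norm_of_nonneg]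
  exact tsum_nonneg fun n => mul_nonneg (h.data.coeff_nonneg n) (Real.exp_pos _).le

lemma norm_le_norm_re (h : StrongHypothesis α δ κ m C a l A) (hδ : 0 < δ) {s : ℂ}
    (hs : α < s.re) : ‖A s‖ ≤ ‖A s.re‖ := by
  rw [h.norm_apply_ofReal hδ hs]
  exact h.norm_le_tsum hδ hs le_rfl

end StrongHypothesis

end Growth

/-! ### Crude growth bounds near the pole line and on the left line -/

section PolynomialGrowth

open Complex Set

/-- The exponent in the polynomial bound for `(s - α) ^ m * A s`. -/
noncomputable def growthExponent (κ : ℝ) (m : ℕ) : ℕ := 2 * m + ⌈κ⌉₊ + 1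

/-- The constant in the polynomial bound for `(s - α) ^ m * A s`. -/
noncomputable def growthConst (α δ κ : ℝ) (m : ℕ) : ℝ :=
  (1 + α / (α - δ)) ^ m * 2 ^ m * (1 + (α - δ)⁻¹) ^ (⌈κ⌉₊ + m) * (α - δ)⁻¹

lemma norm_sub_le_mul_norm {α σ : ℝ} {s : ℂ} (hα : 0 ≤ α) (hσ : 0 < σ) (hs : σ ≤ s.re) :
    ‖s - α‖ ≤ (1 + α / σ) * ‖s‖ := by
  have h1 : σ ≤ ‖s‖ := hs.trans (re_le_norm s)
  calc ‖s - α‖ ≤ ‖s‖ + ‖(α : ℂ)‖ := norm_sub_le _ _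
    _ = ‖s‖ + α / σ * σ := by rw [norm_real, Real.norm_of_nonneg hα, div_mul_cancel₀ _ hσ.ne']
    _ ≤ ‖s‖ + α / σ * ‖s‖ := by gcongr
    _ = _ := by ring

lemma one_add_abs_im_le_mul_norm {σ : ℝ} {s : ℂ} (hσ : 0 < σ) (hs : σ ≤ s.re) :
    1 + |s.im| ≤ (1 + σ⁻¹) * ‖s‖ := by
  have h1 : σ ≤ ‖s‖ := hs.trans (re_le_norm s)
  calc 1 + |s.im| ≤ σ⁻¹ * σ + ‖s‖ := by
        rw [inv_mul_cancel₀ hσ.ne']; gcongr; exact abs_im_le_norm s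
    _ ≤ σ⁻¹ * ‖s‖ + ‖s‖ := by gcongr
    _ = _ := by ring

/-- Since `r ^ 2 = w * conj w`, the sum is `w (w + conj w)`. On the circle this factor vanishes with
`Re w`, so its `m`-th power cancels a blow-up of order `m` at the vertical diameter. -/
lemma norm_sq_add_sq_of_norm_eq {w : ℂ} {r : ℝ} (hw : ‖w‖ = r) :
    ‖w ^ 2 + (r : ℂ) ^ 2‖ = 2 * |w.re| * r := by
  have h1 : w ^ 2 + (r : ℂ) ^ 2 = w * (2 * w.re : ℝ) := by
    rw [← hw, ← mul_conj', ← add_conj]; ring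
  rw [h1, norm_mul, hw, norm_real, Real.norm_eq_abs, abs_mul, abs_two]
  ring

namespace StrongHypothesis

variable {α δ κ C : ℝ} {m : ℕ} {a l : ℕ → ℝ} {A G : ℂ → ℂ}

/-- The finite order of `A` extends a little to the right of the line `Re s = α`. -/
lemma exists_finite_order (h : StrongHypothesis α δ κ m C a l A) (hα : 0 < α) (hδ : 0 < δ)
    (hδα : δ < α) (hG : AnalyticOnNhd ℂ G {s | α - δ ≤ s.re})
    (hGA : ∀ s ≠ (α : ℂ), G s = (s - α) ^ m * A s) :
    ∃ r B M : ℝ, 0 < r ∧ 0 ≤ B ∧ ∀ s : ℂ, α - δ ≤ s.re → s.re ≤ α + r →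
      ‖G s‖ ≤ B * ((1 + |s.im|) ^ m + Real.exp ((|s.im| + (α + 1)) ^ M)) := by
  obtain ⟨M₁, M₂, hM₁, hM₂, hM⟩ := h.finite_order
  set r := min δ 1 with hr
  have hr0 : 0 < r := lt_min hδ one_pos
  have hrδ : r ≤ δ := min_le_left _ _
  have hr1 : r ≤ 1 := min_le_right _ _
  -- Boundedness of `G` on this real segment says that `‖A σ‖` grows at most like `(σ - α) ^ (-m)`
  -- as `σ` decreases to `α`.
  obtain ⟨b, hb⟩ : ∃ b, ∀ σ ∈ Icc α (α + 1), ‖G (σ : ℝ)‖ ≤ b := by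
    refine isCompact_Icc.exists_bound_of_continuousOn (hG.continuousOn.comp
      continuous_ofReal.continuousOn fun σ hσ => ?_)
    simp only [mem_ofPred_eq, ofReal_re]
    linarith [hσ.1]
  have hb0 : 0 ≤ b := (norm_nonneg _).trans (hb α ⟨le_rfl, by linarith⟩)
  set M₁' := max M₁ ‖G α‖ with hM₁'
  have hM₁'0 : 0 ≤ M₁' := hM₁.trans (le_max_left _ _)
  have hleft : ∀ s : ℂ, α - δ ≤ s.re → s.re ≤ α → ‖G s‖ ≤ M₁' * Real.exp (‖s‖ ^ M₂) := by
    intro s hs1 hs2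
    rcases eq_or_ne s α with rfl | hsα
    · calc ‖G α‖ ≤ M₁' * 1 := by rw [mul_one]; exact le_max_right _ _
        _ ≤ _ := by gcongr; exact Real.one_le_exp (by positivity)
    · rw [hGA s hsα]
      refine (hM s hs1 hs2).trans ?_
      gcongr
      exact le_max_left _ _
  set B := (2 ^ m * b + 2 ^ m * M₁') / r ^ (2 * m) + M₁' with hB
  have hB0 : 0 ≤ B := by positivity
  have hBM : M₁' ≤ B := le_add_of_nonneg_left (by positivity)
  refine ⟨r, B, M₂, hr0, hB0, fun s hs1 hs2 => ?_⟩
  set E := Real.exp ((|s.im| + (α + 1)) ^ M₂) with hE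
  have hE0 : 0 < E := Real.exp_pos _
  rcases le_total s.re α with hsα | hsα
  · calc ‖G s‖ ≤ M₁' * Real.exp (‖s‖ ^ M₂) := hleft s hs1 hsα
      _ ≤ B * E := by
        have h1 : ‖s‖ ≤ |s.im| + (α + 1) := by
          have := norm_le_abs_re_add_abs_im s
          rw [abs_of_nonneg (by linarith : 0 ≤ s.re)] at this
          linarith
        rw [hE]
        gcongr
      _ ≤ _ := by gcongr; exact le_add_of_nonneg_left (by positivity)
  set z₀ : ℂ := α + s.im * I with hz₀
  have hz₀re : z₀.re = α := by simp [hz₀]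
  have hz₀im : z₀.im = s.im := by simp [hz₀]
  have hz₀n : ‖z₀‖ ≤ α + |s.im| := by
    have := norm_le_abs_re_add_abs_im z₀
    rwa [hz₀re, hz₀im, abs_of_pos hα] at this
  -- To the right of `α`, `‖A z‖ ≤ ‖A z.re‖` may blow up at the line; the extra factor compensates
  -- for this on the circle about `z₀`. The left half of the circle is covered by the finite-order
  -- hypothesis, and the maximum principle then reaches `s`.
  set H : ℂ → ℂ := fun z => G z * ((z - z₀) ^ 2 + (r : ℂ) ^ 2) ^ m with hH
  have hHs : ∀ z ∈ Metric.sphere z₀ r,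
      ‖H z‖ ≤ 2 ^ m * b * (1 + |s.im|) ^ m + 2 ^ m * M₁' * E := by
    intro z hz
    rw [mem_sphere_iff_norm] at hz
    have hre := hz ▸ abs_re_le_norm (z - z₀)
    rw [sub_re, hz₀re] at hre
    have hre' := abs_le.1 hre
    have hfac : ‖((z - z₀) ^ 2 + (r : ℂ) ^ 2) ^ m‖ = (2 * |z.re - α| * r) ^ m := by
      rw [norm_pow, norm_sq_add_sq_of_norm_eq hz, sub_re, hz₀re]
    rw [hH, norm_mul, hfac]
    rcases le_or_gt z.re α with hzα | hzα
    · have h1 : ‖z‖ ≤ |s.im| + (α + 1) := by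
        have : ‖z‖ ≤ ‖z - z₀‖ + ‖z₀‖ := by simpa using norm_add_le (z - z₀) z₀
        linarith
      calc _ ≤ M₁' * Real.exp (‖z‖ ^ M₂) * (2 * 1 * 1) ^ m := by
            gcongr
            · exact hleft z (by linarith) hzα
            · linarith
        _ ≤ M₁' * E * (2 * 1 * 1) ^ m := by rw [hE]; gcongr
        _ = 2 ^ m * M₁' * E := by ring
        _ ≤ _ := le_add_of_nonneg_left (by positivity)
    · have hzne : z ≠ α := fun hh => by rw [hh, ofReal_re] at hzα; exact lt_irrefl _ hzα
      have hrne : ((z.re : ℝ) : ℂ) ≠ α := by exact_mod_cast hzα.ne'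
      have hza : ‖z - α‖ ≤ 1 + |s.im| := by
        have h1 : z - α = (z - z₀) + s.im * I := by rw [hz₀]; ring
        have h2 : ‖(s.im * I : ℂ)‖ = |s.im| := by simp
        calc ‖z - α‖ ≤ ‖z - z₀‖ + ‖(s.im * I : ℂ)‖ := by rw [h1]; exact norm_add_le _ _
          _ ≤ _ := by rw [h2]; linarith
      have hzb : |z.re - α| ^ m * ‖A z.re‖ ≤ b := by
        have := hb z.re ⟨hzα.le, by linarith⟩
        rw [hGA _ hrne, norm_mul, norm_pow, ← ofReal_sub, norm_real] at this
        exact this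
      rw [hGA z hzne, norm_mul, norm_pow]
      calc _ ≤ (1 + |s.im|) ^ m * ‖A z.re‖ * (2 * |z.re - α| * 1) ^ m := by
            gcongr
            exact h.norm_le_norm_re hδ hzα
        _ = 2 ^ m * (|z.re - α| ^ m * ‖A z.re‖) * (1 + |s.im|) ^ m := by ring
        _ ≤ 2 ^ m * b * (1 + |s.im|) ^ m := by gcongr
        _ ≤ _ := le_add_of_nonneg_right (by positivity)
  have hHd : DiffContOnCl ℂ H (Metric.ball z₀ r) := by
    refine DifferentiableOn.diffContOnCl fun z hz => ?_
    rw [closure_ball _ hr0.ne', mem_closedBall_iff_norm] at hz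
    have hre := (abs_re_le_norm (z - z₀)).trans hz
    rw [sub_re, hz₀re] at hre
    have hre' := abs_le.1 hre
    have := (hG z (by simp only [mem_ofPred_eq]; linarith)).differentiableAt
    exact (this.mul (by fun_prop)).differentiableWithinAt
  have hsz : s - z₀ = ((s.re - α : ℝ) : ℂ) := by
    apply Complex.ext <;> simp [hz₀]
  have hmem : s ∈ closure (Metric.ball z₀ r) := by
    rw [closure_ball _ hr0.ne', mem_closedBall_iff_norm, hsz, norm_real, Real.norm_eq_abs,
      abs_of_nonneg (by linarith)]
    linarith
  have hmax := norm_le_of_forall_mem_frontier_norm_le Metric.isBounded_ball hHd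
    (by rw [frontier_ball _ hr0.ne']; exact hHs) hmem
  -- The point `s` lies on the horizontal radius, where the extra factor is at least `r ^ (2 * m)`.
  have hlow : ‖G s‖ * r ^ (2 * m) ≤ ‖H s‖ := by
    have h1 : (s - z₀) ^ 2 + (r : ℂ) ^ 2 = (((s.re - α) ^ 2 + r ^ 2 : ℝ) : ℂ) := by
      rw [hsz]; push_cast; ring
    rw [hH, norm_mul, norm_pow, h1, norm_real, Real.norm_of_nonneg (by positivity), pow_mul]
    gcongr
    nlinarith [sq_nonneg (s.re - α)]
  have hdiv : ‖G s‖ ≤ (2 ^ m * b * (1 + |s.im|) ^ m + 2 ^ m * M₁' * E) / r ^ (2 * m) := by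
    rw [le_div_iff₀ (by positivity)]
    exact hlow.trans hmax
  refine hdiv.trans ?_
  have h1 : 0 ≤ (1 + |s.im|) ^ m := by positivity
  have h2 : B * ((1 + |s.im|) ^ m + E) =
      (2 ^ m * b * (1 + |s.im|) ^ m + 2 ^ m * M₁' * E) / r ^ (2 * m) +
      ((2 ^ m * b * E + 2 ^ m * M₁' * (1 + |s.im|) ^ m) / r ^ (2 * m) +
        M₁' * ((1 + |s.im|) ^ m + E)) := by
    rw [hB]; ring
  rw [h2]
  exact le_add_of_nonneg_right (by positivity)

/-- In the exponent `2 * m + ⌈κ⌉₊ + 1`, one `m` comes from `(s - α) ^ m`, the other from a crude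
power bound for the logarithm, and `⌈κ⌉₊` from the growth hypothesis. The last unit is free because
`‖s‖ ≥ α - δ`. -/
lemma norm_le_on_left_line (h : StrongHypothesis α δ κ m C a l A) (hα : 0 < α) (hδ : 0 < δ)
    (hδα : δ < α) (hC : 0 ≤ C) (hGA : ∀ s ≠ (α : ℂ), G s = (s - α) ^ m * A s)
    {s : ℂ} (hs : s.re = α - δ) :
    ‖G s‖ ≤ C * growthConst α δ κ m * ‖s‖ ^ growthExponent κ m := by
  have hσ : 0 < α - δ := by linarith
  have hsα : s ≠ α := fun hh => by rw [hh, ofReal_re] at hs; linarith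
  have hsn : α - δ ≤ ‖s‖ := hs ▸ re_le_norm s
  have hlog : Real.log (3 + |s.im|) ^ (m - 1) ≤ (2 * (1 + |s.im|)) ^ m := by
    have h0 : 0 ≤ |s.im| := abs_nonneg _
    have h1 := Real.log_le_sub_one_of_pos (by positivity : 0 < 3 + |s.im|)
    have h2 : 0 ≤ Real.log (3 + |s.im|) := Real.log_nonneg (by linarith)
    calc _ ≤ (2 * (1 + |s.im|)) ^ (m - 1) := by gcongr; linarith
      _ ≤ _ := by gcongr; exacts [by linarith, by omega]
  have hrpow : (1 + |s.im|) ^ κ ≤ (1 + |s.im|) ^ ⌈κ⌉₊ := by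
    rw [← Real.rpow_natCast]
    exact Real.rpow_le_rpow_of_exponent_le (by linarith [abs_nonneg s.im]) (Nat.le_ceil κ)
  have h1 := norm_sub_le_mul_norm hα.le hσ hs.ge
  have h2 := one_add_abs_im_le_mul_norm hσ hs.ge
  rw [hGA s hsα, norm_mul, norm_pow]
  calc ‖s - α‖ ^ m * ‖A s‖
      ≤ ‖s - α‖ ^ m * (C * (1 + |s.im|) ^ ⌈κ⌉₊ * (2 * (1 + |s.im|)) ^ m) := by
        gcongr
        have hl0 : 0 ≤ Real.log (3 + |s.im|) := Real.log_nonneg (by linarith [abs_nonneg s.im])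
        exact (h.growth s hs).trans (by gcongr)
    _ = ‖s - α‖ ^ m * (C * 2 ^ m * (1 + |s.im|) ^ (⌈κ⌉₊ + m)) := by rw [mul_pow]; ring
    _ ≤ ((1 + α / (α - δ)) * ‖s‖) ^ m *
        (C * 2 ^ m * ((1 + (α - δ)⁻¹) * ‖s‖) ^ (⌈κ⌉₊ + m)) := by gcongr
    _ = C * ((1 + α / (α - δ)) ^ m * 2 ^ m * (1 + (α - δ)⁻¹) ^ (⌈κ⌉₊ + m)) *
        ‖s‖ ^ (2 * m + ⌈κ⌉₊) * 1 := by rw [mul_pow, mul_pow]; ring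
    _ ≤ C * ((1 + α / (α - δ)) ^ m * 2 ^ m * (1 + (α - δ)⁻¹) ^ (⌈κ⌉₊ + m)) *
        ‖s‖ ^ (2 * m + ⌈κ⌉₊) * ((α - δ)⁻¹ * ‖s‖) := by
        gcongr
        rw [inv_mul_eq_div, one_le_div hσ]
        exact hsn
    _ = _ := by rw [growthConst, growthExponent]; ring

/-- Any finite order fits the double-exponential growth that Phragmén–Lindelöf allows in a strip,
whatever the width of the strip. -/
lemma isBigO_exp_exp {m : ℕ} {D M c : ℝ} (hc : 0 < c) :
    ∃ P : ℝ, (fun y : ℝ => (1 + y) ^ m + Real.exp ((y + D) ^ M)) =O[atTop]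
      fun y => Real.exp (P * Real.exp (c * y)) := by
  -- The first summand absorbs `(1 + y) ^ m ≤ e ^ (m y)` by `c y ≤ e ^ (c y)`; the second absorbs
  -- the shift by `D`.
  refine ⟨m / c + Real.exp (c * D), ?_⟩
  have h1 := (isLittleO_rpow_exp_pos_mul_atTop M hc).comp_tendsto
    (tendsto_atTop_add_const_right atTop D tendsto_id)
  refine Asymptotics.IsBigO.add (Asymptotics.IsBigO.of_bound 1 ?_)
    (Asymptotics.IsBigO.of_bound 1 ?_)
  · filter_upwards [eventually_ge_atTop 0] with y hy
    rw [Real.norm_of_nonneg (by positivity), Real.norm_of_nonneg (Real.exp_pos _).le, one_mul]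
    calc (1 + y) ^ m ≤ (Real.exp y) ^ m := by gcongr; rw [add_comm]; exact Real.add_one_le_exp y
      _ = Real.exp (m / c * (c * y)) := by rw [← Real.exp_nat_mul]; congr 1; field_simp
      _ ≤ _ := by
        have h2 : c * y ≤ Real.exp (c * y) := by linarith [Real.add_one_le_exp (c * y)]
        have h3 : 0 ≤ Real.exp (c * D) := (Real.exp_pos _).le
        have h4 : (0 : ℝ) ≤ m / c := by positivity
        have h5 : 0 < Real.exp (c * y) := Real.exp_pos _
        rw [Real.exp_le_exp]
        nlinarith [mul_le_mul_of_nonneg_left h2 h4, mul_nonneg h3 h5.le]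
  · filter_upwards [h1.bound one_pos] with y hy
    rw [Real.norm_of_nonneg (Real.exp_pos _).le, Real.norm_of_nonneg (Real.exp_pos _).le, one_mul,
      Real.exp_le_exp]
    simp only [Function.comp, id, one_mul, Real.norm_eq_abs, Real.abs_exp] at hy
    refine (le_abs_self _).trans (hy.trans ?_)
    have h2 : Real.exp (c * (y + D)) = Real.exp (c * D) * Real.exp (c * y) := by
      rw [← Real.exp_add]; congr 1; ring
    rw [h2, add_mul]
    exact le_add_of_nonneg_left (by positivity)

end StrongHypothesis

end PolynomialGrowth

/-! ### Phragmén–Lindelöf: a bound depending on the series only through `C` -/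

section PhragmenLindelofBound

open Complex Set

namespace StrongHypothesis

variable {α δ κ C : ℝ} {m : ℕ} {a l : ℕ → ℝ} {A G : ℂ → ℂ}

/-- Here `A` is bounded by its value at `b`, and since `N ≥ m + 1` the quotient decays at least like
`‖s‖⁻¹`. -/
lemma norm_div_pow_le_of_right (h : StrongHypothesis α δ κ m C a l A) (hα : 0 < α) (hδ : 0 < δ)
    (hδα : δ < α) (hGA : ∀ s ≠ (α : ℂ), G s = (s - α) ^ m * A s) {b : ℝ} (hb : α < b)
    {s : ℂ} (hs : b ≤ s.re) {N : ℕ} (hN : m + 1 ≤ N) :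
    ‖G s / s ^ N‖ ≤ (1 + α / (α - δ)) ^ m * (∑' n, a n * Real.exp (-(Real.log (l n) * b))) *
      ((α - δ)⁻¹) ^ (N - (m + 1)) * ‖s‖⁻¹ := by
  have hσ : 0 < α - δ := by linarith
  have hsn : α - δ ≤ ‖s‖ := by have := re_le_norm s; linarith
  have hs0 : 0 < ‖s‖ := hσ.trans_le hsn
  have hsα : s ≠ α := fun hh => by rw [hh, ofReal_re] at hs; linarith
  obtain ⟨k, rfl⟩ := Nat.exists_eq_add_of_le hN
  rw [hGA s hsα, norm_div, norm_mul, norm_pow, norm_pow, Nat.add_sub_cancel_left]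
  set S := ∑' n, a n * Real.exp (-(Real.log (l n) * b)) with hS
  have h1 : ‖A s‖ ≤ S := h.norm_le_tsum hδ hb hs
  have h0 : 0 ≤ S := (norm_nonneg _).trans h1
  have h2 := norm_sub_le_mul_norm (s := s) hα.le hσ (by linarith)
  calc ‖s - α‖ ^ m * ‖A s‖ / ‖s‖ ^ (m + 1 + k)
      ≤ ((1 + α / (α - δ)) * ‖s‖) ^ m * S / ‖s‖ ^ (m + 1 + k) := by gcongr
    _ = (1 + α / (α - δ)) ^ m * S * (‖s‖⁻¹) ^ k * ‖s‖⁻¹ := by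
      rw [mul_pow, pow_add, pow_succ, inv_pow]; field_simp
    _ ≤ _ := by gcongr

/-- The bound `B` may depend on the whole series. It is needed only to license Phragmén–Lindelöf in
the half-plane, which forgets it. -/
lemma norm_div_pow_le (h : StrongHypothesis α δ κ m C a l A) (hα : 0 < α) (hδ : 0 < δ)
    (hδα : δ < α) (hC : 0 ≤ C) (hG : AnalyticOnNhd ℂ G {s | α - δ ≤ s.re})
    (hGA : ∀ s ≠ (α : ℂ), G s = (s - α) ^ m * A s) :
    ∃ B : ℝ, ∀ s : ℂ, α - δ ≤ s.re → ‖G s / s ^ growthExponent κ m‖ ≤ B := by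
  have hσ : 0 < α - δ := by linarith
  set N := growthExponent κ m with hN
  have hmN : m + 1 ≤ N := by rw [hN, growthExponent]; omega
  obtain ⟨r, B, M, hr, hB, hGB⟩ := h.exists_finite_order hα hδ hδα hG hGA
  set Br := (1 + α / (α - δ)) ^ m * (∑' n, a n * Real.exp (-(Real.log (l n) * (α + r)))) *
      ((α - δ)⁻¹) ^ (N - (m + 1)) * (α - δ)⁻¹ with hBr
  have hright : ∀ s : ℂ, α + r ≤ s.re → ‖G s / s ^ N‖ ≤ Br := by
    intro s hs
    refine (h.norm_div_pow_le_of_right hα hδ hδα hGA (by linarith) hs hmN).trans ?_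
    have : 0 ≤ ∑' n, a n * Real.exp (-(Real.log (l n) * (α + r))) :=
      tsum_nonneg fun n => mul_nonneg (h.data.coeff_nonneg n) (Real.exp_pos _).le
    have hsn : α - δ ≤ ‖s‖ := by have := re_le_norm s; linarith
    rw [hBr]
    gcongr
  set Bl := C * growthConst α δ κ m with hBl
  have hs0 : ∀ s : ℂ, α - δ ≤ s.re → 0 < ‖s‖ := fun s hs => by have := re_le_norm s; linarith
  have hleft : ∀ s : ℂ, s.re = α - δ → ‖G s / s ^ N‖ ≤ Bl := by
    intro s hs
    have := hs0 s hs.ge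
    rw [norm_div, norm_pow, div_le_iff₀ (by positivity)]
    exact h.norm_le_on_left_line hα hδ hδα hC hGA hs
  refine ⟨max Bl Br, fun s hs => ?_⟩
  rcases le_total (α + r) s.re with hsr | hsr
  · exact (hright s hsr).trans (le_max_right _ _)
  have hw : 0 < (α + r) - (α - δ) := by linarith
  refine PhragmenLindelof.vertical_strip (f := fun s => G s / s ^ N) (a := α - δ) (b := α + r)
    ?_ ?_ (fun z hz => (hleft z hz).trans (le_max_left _ _))
    (fun z hz => (hright z hz.ge).trans (le_max_right _ _)) hs hsr
  · refine DifferentiableOn.diffContOnCl fun z hz => ?_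
    have hz' : z ∈ {s : ℂ | α - δ ≤ s.re} :=
      closure_minimal (fun z hz => hz.1.le) (isClosed_le continuous_const continuous_re) hz
    exact ((hG z hz').differentiableAt.div (differentiableAt_id.pow N)
      (pow_ne_zero _ (norm_pos_iff.1 (hs0 z hz')))).differentiableWithinAt
  · obtain ⟨c, hc0, hc⟩ := exists_between (div_pos Real.pi_pos hw)
    obtain ⟨P, hP⟩ := isBigO_exp_exp (m := m) (D := α + 1) (M := M) hc0
    refine ⟨c, hc, P, ?_⟩
    have hP' := (hP.comp_tendsto (tendsto_comap (f := _root_.abs ∘ im))).mono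
      (inf_le_left (b := 𝓟 (re ⁻¹' Ioo (α - δ) (α + r))))
    refine Asymptotics.IsBigO.trans (Asymptotics.IsBigO.of_bound (B * ((α - δ)⁻¹) ^ N) ?_) hP'
    filter_upwards [mem_inf_of_right (mem_principal_self _)] with z hz
    have hzn : α - δ ≤ ‖z‖ := by have := re_le_norm z; linarith [hz.1]
    have h1 := hGB z hz.1.le hz.2.le
    simp only [Function.comp]
    rw [norm_div, norm_pow, Real.norm_of_nonneg (by positivity), div_eq_mul_inv, ← inv_pow]
    calc _ ≤ B * ((1 + |z.im|) ^ m + Real.exp ((|z.im| + (α + 1)) ^ M)) * ((α - δ)⁻¹) ^ N := by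
          gcongr
      _ = _ := by ring

/-- A polynomial bound for `(s - α) ^ m * A s` that depends on the series only through `C`. -/
theorem norm_le_growthConst_mul (h : StrongHypothesis α δ κ m C a l A) (hα : 0 < α) (hδ : 0 < δ)
    (hδα : δ < α) (hC : 0 ≤ C) (hG : AnalyticOnNhd ℂ G {s | α - δ ≤ s.re})
    (hGA : ∀ s ≠ (α : ℂ), G s = (s - α) ^ m * A s) {s : ℂ} (hs : α - δ ≤ s.re) :
    ‖G s‖ ≤ C * growthConst α δ κ m * ‖s‖ ^ growthExponent κ m := by
  have hσ : 0 < α - δ := by linarith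
  set N := growthExponent κ m with hN
  have hmN : m + 1 ≤ N := by rw [hN, growthExponent]; omega
  obtain ⟨B, hB⟩ := h.norm_div_pow_le hα hδ hδα hC hG hGA
  have hs0 : ∀ s : ℂ, α - δ ≤ s.re → 0 < ‖s‖ := fun s hs => by have := re_le_norm s; linarith
  have hre : ∀ z : ℂ, (z + ((α - δ : ℝ) : ℂ)).re = z.re + (α - δ) := fun z => by simp
  have key := PhragmenLindelof.right_half_plane_of_tendsto_zero_on_real
    (f := fun z => G (z + ((α - δ : ℝ) : ℂ)) / (z + ((α - δ : ℝ) : ℂ)) ^ N)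
    (C := C * growthConst α δ κ m) (z := s - ((α - δ : ℝ) : ℂ)) ?_ ?_ ?_ ?_ ?_
  · simp only [sub_add_cancel, norm_div, norm_pow] at key
    have := hs0 s hs
    rwa [div_le_iff₀ (by positivity)] at key
  · refine DifferentiableOn.diffContOnCl fun z hz => ?_
    rw [closure_setOfPred_lt_re] at hz
    have hz0 : (0 : ℝ) ≤ z.re := hz
    have hz' : α - δ ≤ (z + ((α - δ : ℝ) : ℂ)).re := by rw [hre]; linarith
    have h1 : DifferentiableAt ℂ (fun z : ℂ => z + ((α - δ : ℝ) : ℂ)) z := by fun_prop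
    exact (DifferentiableAt.div ((hG _ hz').differentiableAt.comp z h1) (h1.pow N)
      (pow_ne_zero _ (norm_pos_iff.1 (hs0 _ hz')))).differentiableWithinAt
  -- With coefficient `0` the comparison function is the constant `1`, so the growth condition is
  -- plain boundedness.
  · refine ⟨1, by norm_num, 0, Asymptotics.IsBigO.of_bound B ?_⟩
    filter_upwards [mem_inf_of_right (mem_principal_self _)] with z hz
    have hz0 : (0 : ℝ) < z.re := hz
    simpa using hB (z + ((α - δ : ℝ) : ℂ)) (by rw [hre]; linarith)
  · have hlim : Tendsto (fun x : ℝ => (1 + α / (α - δ)) ^ m *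
        (∑' n, a n * Real.exp (-(Real.log (l n) * (α + 1)))) *
        ((α - δ)⁻¹) ^ (N - (m + 1)) * (x + (α - δ))⁻¹) atTop (𝓝 0) := by
      have := (tendsto_inv_atTop_zero (𝕜 := ℝ)).comp
        (tendsto_atTop_add_const_right atTop (α - δ) tendsto_id)
      simpa using this.const_mul _
    refine squeeze_zero_norm' ?_ hlim
    filter_upwards [eventually_ge_atTop (δ + 1)] with x hx
    have h1 := h.norm_div_pow_le_of_right (s := x + ((α - δ : ℝ) : ℂ)) hα hδ hδα hGA
      (b := α + 1) (by linarith) (by rw [hre, ofReal_re]; linarith) hmN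
    rwa [← ofReal_add, norm_real, Real.norm_of_nonneg (by linarith), ofReal_add] at h1
  · intro x
    have hx : (x * I + ((α - δ : ℝ) : ℂ)).re = α - δ := by simp
    have := hs0 _ hx.ge
    rw [norm_div, norm_pow, div_le_iff₀ (by positivity)]
    exact h.norm_le_on_left_line hα hδ hδα hC hGA hx
  · simp only [sub_re, ofReal_re]; linarith

end StrongHypothesis

end PhragmenLindelofBound

/-! ### Perron's formula and the contour shift -/

section Perron

open MeasureTheory Complex Set

lemma residue_eq_circleIntegral {f : ℂ → ℂ} {z₀ : ℂ} {R : ℝ} (hR : 0 < R)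
    (hf : ∀ z, z ≠ z₀ → ‖z - z₀‖ ≤ R → DifferentiableAt ℂ f z) :
    residue f z₀ = (2 * (Real.pi : ℂ) * I)⁻¹ * ∮ z in C(z₀, R), f z := by
  refine Tendsto.limUnder_eq (tendsto_const_nhds.congr' ?_)
  filter_upwards [Ioo_mem_nhdsGT hR] with r hr
  congr 1
  refine circleIntegral_eq_of_differentiable_on_annulus_off_countable hr.1 hr.2.le
    countable_empty (fun z hz => ?_) fun z hz => ?_
  · refine (hf z (fun hh => hz.2 ?_) ?_).continuousAt.continuousWithinAt
    · rw [hh]; exact Metric.mem_ball_self hr.1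
    · exact mem_closedBall_iff_norm.1 hz.1
  · refine hf z (fun hh => hz.1.2 ?_) ?_
    · rw [hh]; exact Metric.mem_closedBall_self hr.1.le
    · exact (mem_ball_iff_norm.1 hz.1.1).le

lemma differentiableAt_smoothKernel (η : ℝ) (j : ℕ) {s : ℂ} (hs : s ≠ 0) :
    DifferentiableAt ℂ (smoothKernel η j) s :=
  ((differentiable_expAvg η s).pow j).div differentiableAt_id hs

namespace StrongHypothesis

variable {α δ κ C : ℝ} {m : ℕ} {a l : ℕ → ℝ} {A G : ℂ → ℂ}

/-- On `Re s = c > α` the series converges absolutely with a bound independent of `t`, and the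
kernel is integrable, so summation and integration commute. -/
lemma hasSum_smoothStep (h : StrongHypothesis α δ κ m C a l A) (hα : 0 < α) (hδ : 0 < δ)
    {η : ℝ} (hη : |η| ≤ 1) (hη0 : η ≠ 0) (j : ℕ) (v : ℝ) {c : ℝ} (hc : α < c) :
    HasSum (fun n => ((a n * smoothStep η (j + 1) (v - Real.log (l n)) : ℝ) : ℂ))
      ((1 / (2 * Real.pi) : ℂ) * ∫ t : ℝ, A (c + t * I) *
        (exp ((c + t * I) * v) * smoothKernel η (j + 1) (c + t * I))) := by
  have hc0 : 0 < c := hα.trans hc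
  set F : ℕ → ℝ → ℂ := fun n t => (a n : ℂ) * (exp ((c + t * I) * ((v - Real.log (l n) : ℝ) : ℂ)) *
    smoothKernel η (j + 1) (c + t * I)) with hF
  have hFeq : ∀ n t, F n t = (a n : ℂ) * (l n : ℂ) ^ (-(c + t * I : ℂ)) *
      (exp ((c + t * I) * v) * smoothKernel η (j + 1) (c + t * I)) := by
    intro n t
    rw [cpow_neg_eq_exp (zero_lt_one.trans_le (h.data.one_le_apply n)), hF]
    simp only
    rw [mul_assoc, ← mul_assoc (exp _) (exp _), ← Complex.exp_add]
    congr 4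
    push_cast
    ring
  have hint : ∀ n, Integrable (F n) := fun n =>
    (integrable_exp_mul_smoothKernel j hη hη0 hc0 _).const_mul _
  have hsum : Summable fun n => ∫ t, ‖F n t‖ := by
    refine ((h.summable_exp hδ hc).mul_right
      (∫ t : ℝ, ‖exp ((c + t * I) * v) * smoothKernel η (j + 1) (c + t * I)‖)).congr fun n => ?_
    rw [← integral_const_mul]
    congr 1
    ext t
    rw [hFeq, norm_mul (_ * _), h.norm_term]
    simp
  have key := (hasSum_integral_of_summable_integral_norm hint hsum).mul_left
    (1 / (2 * Real.pi) : ℂ)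
  have hA : (fun t => ∑' n, F n t) = fun t : ℝ => A (c + t * I) *
      (exp ((c + t * I) * v) * smoothKernel η (j + 1) (c + t * I)) := by
    ext t
    simp_rw [hFeq]
    rw [tsum_mul_right, (h.hasSum_of_lt_re hδ (by simpa)).tsum_eq]
  rw [hA] at key
  refine key.congr_fun fun n => ?_
  simp only [hF]
  rw [integral_const_mul, mul_left_comm, integral_exp_mul_smoothKernel j hη hη0 hc0]
  push_cast
  rfl

/-- With `N + 1` averages the kernel decays like `‖s‖ ^ (-(N + 2))`, which beats the growth `‖s‖ ^
N` of `G` by two powers. -/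
lemma exists_norm_integrand_le (h : StrongHypothesis α δ κ m C a l A) (hα : 0 < α) (hδ : 0 < δ)
    (hδα : δ < α) (hC : 0 ≤ C) (hG : AnalyticOnNhd ℂ G {s | α - δ ≤ s.re})
    (hGA : ∀ s ≠ (α : ℂ), G s = (s - α) ^ m * A s) {η : ℝ} (hη : |η| ≤ 1) (hη0 : η ≠ 0) (v c : ℝ) :
    ∃ B : ℝ, 0 ≤ B ∧ ∀ s : ℂ, α - δ ≤ s.re → s.re ≤ c →
      ‖G s * (exp (s * v) * smoothKernel η (growthExponent κ m + 1) s)‖ ≤ B / ‖s‖ ^ 2 := by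
  have hgc : 0 ≤ growthConst α δ κ m := by
    have : 0 < α - δ := by linarith
    unfold growthConst; positivity
  set N := growthExponent κ m with hN
  refine ⟨C * growthConst α δ κ m * Real.exp (c * |v|) * (2 * Real.exp c / |η|) ^ (N + 1),
    by positivity, fun s hs hsc => ?_⟩
  have hs1 : 0 < s.re := by linarith
  have hs0 : 0 < ‖s‖ := hs1.trans_le (re_le_norm s)
  have h1 := h.norm_le_growthConst_mul hα hδ hδα hC hG hGA hs
  have h2 := norm_smoothKernel_le (N + 1) hη hη0 hs1 hsc
  have h3 : ‖exp (s * v)‖ ≤ Real.exp (c * |v|) := by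
    rw [norm_exp, re_mul_ofReal, Real.exp_le_exp]
    calc s.re * v ≤ s.re * |v| := by gcongr; exact le_abs_self v
      _ ≤ _ := by gcongr
  rw [norm_mul, norm_mul]
  calc _ ≤ C * growthConst α δ κ m * ‖s‖ ^ N * (Real.exp (c * |v|) *
        ((2 * Real.exp c / |η|) ^ (N + 1) / ‖s‖ ^ (N + 1 + 1))) := by gcongr
    _ = _ := by
      have : ‖s‖ ^ (N + 1 + 1) = ‖s‖ ^ N * ‖s‖ ^ 2 := by ring
      rw [this]
      field_simp

lemma integral_line_eq (h : StrongHypothesis α δ κ m C a l A) (hα : 0 < α) (hδ : 0 < δ)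
    (hδα : δ < α) (hC : 0 ≤ C) (hG : AnalyticOnNhd ℂ G {s | α - δ ≤ s.re})
    (hGA : ∀ s ≠ (α : ℂ), G s = (s - α) ^ m * A s) {η : ℝ} (hη : |η| ≤ 1) (hη0 : η ≠ 0) (v : ℝ)
    {r : ℝ} (hr : 0 < r) (hrδ : r ≤ δ) (hr1 : r ≤ 1) {k : ℕ} (hk : k = growthExponent κ m + 1) :
    (1 / (2 * Real.pi) : ℂ) * (∫ t : ℝ, A ((α + 1 : ℝ) + t * I) *
        (exp (((α + 1 : ℝ) + t * I) * v) * smoothKernel η k ((α + 1 : ℝ) + t * I)))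
      = (2 * (Real.pi : ℂ) * I)⁻¹ *
          (∮ z in C(α, r), G z * (exp (z * v) * smoothKernel η k z) * ((z - α) ^ m)⁻¹)
        + (1 / (2 * Real.pi) : ℂ) * (∫ t : ℝ, A ((α - δ : ℝ) + t * I) *
          (exp (((α - δ : ℝ) + t * I) * v) * smoothKernel η k ((α - δ : ℝ) + t * I))) := by
  subst hk
  set k := growthExponent κ m + 1 with hk
  have hσ : 0 < α - δ := by linarith
  obtain ⟨B, hB0, hB⟩ := h.exists_norm_integrand_le hα hδ hδα hC hG hGA hη hη0 v (α + 1)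
  set g : ℂ → ℂ := fun s => G s * (exp (s * v) * smoothKernel η k s) with hg
  have hgd : ∀ z : ℂ, α - δ ≤ z.re → DifferentiableAt ℂ g z := fun z hz => by
    refine (hG z hz).differentiableAt.mul (DifferentiableAt.mul (by fun_prop) ?_)
    refine differentiableAt_smoothKernel η k fun hh => ?_
    rw [hh, zero_re] at hz; linarith
  have hline : ∀ c : ℝ, c ≠ α → ∀ t : ℝ, g (c + t * I) * ((c + t * I - α : ℂ) ^ m)⁻¹
      = A (c + t * I) * (exp ((c + t * I) * v) * smoothKernel η k (c + t * I)) := by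
    intro c hc t
    have hne := vertical_ne (y := t) hc
    simp only [hg]
    rw [hGA _ hne]
    have : (c + t * I - α : ℂ) ^ m ≠ 0 := pow_ne_zero _ (sub_ne_zero.2 hne)
    field_simp
  have hint : ∀ c : ℝ, c ≠ α → α - δ ≤ c → c ≤ α + 1 →
      Integrable fun t : ℝ => g (c + t * I) * ((c + t * I - α : ℂ) ^ m)⁻¹ := by
    intro c hcα hc1 hc2
    have hcre : ∀ t : ℝ, (c + t * I : ℂ).re = c := fun t => by simp
    have hdist : ∀ t : ℝ, |c - α| ≤ ‖(c + t * I - α : ℂ)‖ := fun t => by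
      have := abs_re_le_norm (c + t * I - α : ℂ)
      rwa [sub_re, hcre, ofReal_re] at this
    have hpos : 0 < |c - α| := abs_pos.2 (sub_ne_zero.2 hcα)
    refine integrable_of_norm_le_div_sq (c := c) (B := B * (|c - α| ^ m)⁻¹) (by linarith) ?_
      fun t => ?_
    · have h1 : Continuous fun t : ℝ => g (c + t * I) := continuous_iff_continuousAt.2 fun t =>
        ContinuousAt.comp (f := fun t : ℝ => (c + t * I : ℂ))
          (hgd _ (by rw [hcre]; exact hc1)).continuousAt (by fun_prop)
      exact h1.mul (Continuous.inv₀ (by fun_prop) fun t =>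
        pow_ne_zero _ (sub_ne_zero.2 (vertical_ne hcα)))
    · rw [norm_mul, norm_inv, norm_pow, mul_div_right_comm]
      have h1 := hB (c + t * I) (by rw [hcre]; exact hc1) (by rw [hcre]; exact hc2)
      have h2 := hdist t
      gcongr
  have key := integral_line_sub_integral_line (g := g) (a := α - δ) (b := α + 1) (α := α) (r := r)
    (B := B) hr (by linarith) (by linarith) m
    (fun z hz => (hgd z hz.1).differentiableWithinAt) ?_
    (hint _ (by linarith) le_rfl (by linarith)) (hint _ (by linarith) (by linarith) le_rfl)
  · simp_rw [hline (α + 1) (by linarith), hline (α - δ) (by linarith)] at key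
    have hpi : (Real.pi : ℂ) ≠ 0 := by exact_mod_cast Real.pi_ne_zero
    have hI : (1 / (2 * Real.pi) : ℂ) = (2 * (Real.pi : ℂ) * I)⁻¹ * I := by field_simp
    rw [hI]
    linear_combination (2 * (Real.pi : ℂ) * I)⁻¹ * key
  · intro z hz him
    have hz0 : 0 < ‖z‖ := by have := re_le_norm z; linarith [hz.1]
    have h1 := hB z hz.1 hz.2
    have h2 : 1 ≤ ‖z - α‖ := by
      have := abs_im_le_norm (z - α)
      rw [sub_im, ofReal_im, sub_zero] at this
      linarith
    have h3 : |z.im| ≤ ‖z‖ ^ 2 := by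
      have := abs_im_le_norm z
      nlinarith
    rw [norm_mul, norm_inv, norm_pow]
    calc _ ≤ B / ‖z‖ ^ 2 * (1 ^ m)⁻¹ := by gcongr
      _ = B / ‖z‖ ^ 2 := by simp
      _ ≤ _ := by gcongr

end StrongHypothesis

end Perron

/-! ### The integral over the line `Re s = α - δ` -/

section LeftLine

open MeasureTheory Complex Set

/-- The function `y ^ (κ - 1) / (1 + y) ^ p` on the positive half-line, extended by zero. -/
noncomputable def betaFun (κ : ℝ) (p : ℕ) : ℝ → ℝ :=
  indicator (Ioi 0) fun y => y ^ (κ - 1) * ((1 + y) ^ p)⁻¹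

lemma betaFun_nonneg (κ : ℝ) (p : ℕ) (y : ℝ) : 0 ≤ betaFun κ p y := by
  refine indicator_nonneg (fun y hy => ?_) y
  have : (0 : ℝ) < y := hy
  positivity

lemma integrable_betaFun {κ : ℝ} {p : ℕ} (hκ : 0 < κ) (hp : κ < p) : Integrable (betaFun κ p) := by
  have hmeas : Measurable fun y : ℝ => y ^ (κ - 1) * ((1 + y) ^ p)⁻¹ := by fun_prop
  rw [betaFun, integrable_indicator_iff measurableSet_Ioi,
    ← Ioc_union_Ioi_eq_Ioi (zero_le_one' ℝ)]
  refine IntegrableOn.union ?_ ?_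
  · have h1 : IntegrableOn (fun y : ℝ => y ^ (κ - 1)) (Ioc 0 1) := by
      rw [← intervalIntegrable_iff_integrableOn_Ioc_of_le zero_le_one]
      exact intervalIntegral.intervalIntegrable_rpow' (by linarith)
    refine Integrable.mono' h1 hmeas.aestronglyMeasurable
      ((ae_restrict_iff' measurableSet_Ioc).2 (Eventually.of_forall fun y hy => ?_))
    have hy0 : 0 < y := hy.1
    rw [Real.norm_of_nonneg (by positivity)]
    refine mul_le_of_le_one_right (by positivity) (inv_le_one_of_one_le₀ ?_)
    exact one_le_pow₀ (by linarith)
  · refine Integrable.mono' (integrableOn_Ioi_rpow_of_lt (a := κ - 1 - p) (by linarith) one_pos)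
      hmeas.aestronglyMeasurable
      ((ae_restrict_iff' measurableSet_Ioi).2 (Eventually.of_forall fun y hy => ?_))
    have hy0 : 0 < y := zero_lt_one.trans hy
    rw [Real.norm_of_nonneg (by positivity), Real.rpow_sub hy0 (κ - 1) p, Real.rpow_natCast, div_eq_mul_inv]
    gcongr
    linarith

/-- The integral of `betaFun κ p`. -/
noncomputable def betaConst (κ : ℝ) (p : ℕ) : ℝ := ∫ y, betaFun κ p y

lemma betaConst_nonneg (κ : ℝ) (p : ℕ) : 0 ≤ betaConst κ p :=
  integral_nonneg fun y => betaFun_nonneg κ p y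

/-- This is the scaling `y = ε (1 + |t|)`. For either sign of `t`, one of the two terms on the right
is the value at `ε (1 + |t|)` and the other is nonnegative, so the line need not be split. -/
lemma rpow_mul_inv_le_betaFun {κ ε : ℝ} (p : ℕ) (hε : 0 < ε) (t : ℝ) :
    (1 + |t|) ^ (κ - 1) * ((1 + ε * (1 + |t|)) ^ p)⁻¹ ≤
      ε ^ (1 - κ) * (betaFun κ p (ε * (1 + t)) + betaFun κ p (ε * (1 - t))) := by
  have h1 : (1 + |t|) ^ (κ - 1) * ((1 + ε * (1 + |t|)) ^ p)⁻¹ =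
      ε ^ (1 - κ) * betaFun κ p (ε * (1 + |t|)) := by
    have h2 : ε * (1 + |t|) ∈ Ioi (0 : ℝ) := by rw [mem_Ioi]; positivity
    rw [betaFun, indicator_of_mem h2, Real.mul_rpow hε.le (by positivity), ← mul_assoc,
      ← mul_assoc, ← Real.rpow_add hε]
    simp
  rw [h1]
  have := betaFun_nonneg κ p (ε * (1 + t))
  have := betaFun_nonneg κ p (ε * (1 - t))
  gcongr
  rcases le_total 0 t with ht | ht
  · rw [abs_of_nonneg ht]; linarith
  · rw [abs_of_nonpos ht, ← sub_eq_add_neg]; linarith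

lemma integrable_betaFun_comp {κ ε : ℝ} {p : ℕ} (hκ : 0 < κ) (hp : κ < p) (hε : 0 < ε) :
    Integrable fun t => betaFun κ p (ε * (1 + t)) + betaFun κ p (ε * (1 - t)) := by
  have h1 := (integrable_betaFun hκ hp).comp_mul_left' hε.ne'
  exact (h1.comp_add_left 1).add (h1.comp_sub_left 1)

lemma integral_betaFun_comp {κ ε : ℝ} {p : ℕ} (hκ : 0 < κ) (hp : κ < p) (hε : 0 < ε) :
    ∫ t, (betaFun κ p (ε * (1 + t)) + betaFun κ p (ε * (1 - t))) = 2 * ε⁻¹ * betaConst κ p := by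
  have h1 := (integrable_betaFun hκ hp).comp_mul_left' hε.ne'
  have h2 : ∫ t, betaFun κ p (ε * t) = ε⁻¹ * betaConst κ p := by
    rw [Measure.integral_comp_mul_left, abs_of_pos (inv_pos.2 hε), smul_eq_mul, betaConst]
  rw [integral_add (h1.comp_add_left 1) (h1.comp_sub_left 1),
    integral_add_left_eq_self (fun t => betaFun κ p (ε * t)) 1,
    integral_sub_left_eq_self (fun t => betaFun κ p (ε * t)) _ 1, h2]
  ring

/-- The logarithm at height `t` is traded for the one at height `ε⁻¹` times a factor that the kernel
can absorb. This costs `m - 1` averages, hence the exponent `k - (m - 1)` in the beta integral. -/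
lemma log_three_add_le {ε t : ℝ} (hε : 0 < ε) (ht : 0 ≤ t) :
    Real.log (3 + t) ≤ Real.log (3 + ε⁻¹) * (1 + ε * (1 + t)) := by
  have h1 : 1 ≤ Real.log (3 + ε⁻¹) := by
    rw [Real.le_log_iff_exp_le (by positivity)]
    have := Real.exp_one_lt_d9
    have := inv_pos.2 hε
    linarith
  have h2 : 3 + t ≤ (3 + ε⁻¹) * (1 + ε * t) := by
    have : (3 + ε⁻¹) * (1 + ε * t) = 3 + t + ε⁻¹ + 3 * (ε * t) := by field_simp; ring
    rw [this]
    have : 0 ≤ ε * t := by positivity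
    have := inv_pos.2 hε
    linarith
  calc Real.log (3 + t) ≤ Real.log ((3 + ε⁻¹) * (1 + ε * t)) :=
        Real.log_le_log (by positivity) h2
    _ = Real.log (3 + ε⁻¹) + Real.log (1 + ε * t) :=
        Real.log_mul (by positivity) (by positivity)
    _ ≤ Real.log (3 + ε⁻¹) + ε * (1 + t) * 1 := by
        have := Real.log_le_sub_one_of_pos (by positivity : 0 < 1 + ε * t)
        linarith
    _ ≤ Real.log (3 + ε⁻¹) + ε * (1 + t) * Real.log (3 + ε⁻¹) := by gcongr
    _ = _ := by ring

lemma norm_expAvg_le_inv {η σ : ℝ} {s : ℂ} (hη : |η| ≤ 1) (hη0 : η ≠ 0) (hσ : 0 < σ)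
    (hs : s.re = σ) :
    ‖expAvg η s‖ ≤ Real.exp σ * (1 + 2 * (1 + σ⁻¹)) * (1 + |η| * (1 + |s.im|))⁻¹ := by
  have hs0 : 0 < ‖s‖ := by have := re_le_norm s; linarith
  have hη' : 0 < |η| := abs_pos.2 hη0
  rw [← div_eq_mul_inv, le_div_iff₀ (by positivity)]
  have h1 := norm_expAvg_le hη (hs ▸ hσ.le) hs.le
  have h2 := norm_expAvg_le_div hη hη0 (hs ▸ hσ) hs.le
  rw [le_div_iff₀ (by positivity)] at h2
  have h3 := one_add_abs_im_le_mul_norm hσ hs.ge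
  calc ‖expAvg η s‖ * (1 + |η| * (1 + |s.im|))
      ≤ ‖expAvg η s‖ * (1 + |η| * ((1 + σ⁻¹) * ‖s‖)) := by gcongr
    _ = ‖expAvg η s‖ + (1 + σ⁻¹) * (‖expAvg η s‖ * (|η| * ‖s‖)) := by ring
    _ ≤ Real.exp σ + (1 + σ⁻¹) * (2 * Real.exp σ) := by gcongr
    _ = _ := by ring

/-- The constant in the bound for the integral over the line `Re s = α - δ`. -/
noncomputable def lineConst (σ κ : ℝ) (m k : ℕ) : ℝ :=
  (Real.exp σ * (1 + 2 * (1 + σ⁻¹))) ^ k * (1 + σ⁻¹) * (2 * betaConst κ (k - (m - 1)))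

namespace StrongHypothesis

variable {α δ κ C : ℝ} {m : ℕ} {a l : ℕ → ℝ} {A : ℂ → ℂ}

lemma norm_integral_left_line_le (h : StrongHypothesis α δ κ m C a l A)
    (hδα : δ < α) (hκ : 0 < κ) (hC : 0 ≤ C) {η : ℝ} (hη : |η| ≤ 1) (hη0 : η ≠ 0) (v : ℝ)
    {k : ℕ} (hk : m - 1 ≤ k) (hp : κ < (k - (m - 1) : ℕ)) :
    ‖∫ t : ℝ, A ((α - δ : ℝ) + t * I) *
      (exp (((α - δ : ℝ) + t * I) * v) * smoothKernel η k ((α - δ : ℝ) + t * I))‖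
      ≤ C * lineConst (α - δ) κ m k * Real.exp ((α - δ) * v) *
        (|η| ^ (-κ) * Real.log (3 + |η|⁻¹) ^ (m - 1)) := by
  set σ := α - δ with hσdef
  have hσ : 0 < σ := by rw [hσdef]; linarith
  set ε := |η| with hε
  have hε0 : 0 < ε := abs_pos.2 hη0
  set p := k - (m - 1) with hpdef
  set D := Real.exp σ * (1 + 2 * (1 + σ⁻¹)) with hD
  have hD0 : 0 ≤ D := by positivity
  set Λ := Real.log (3 + ε⁻¹) with hΛ
  have hΛ0 : 0 ≤ Λ := Real.log_nonneg (by have := inv_pos.2 hε0; linarith)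
  set c₀ := C * Real.exp (σ * v) * D ^ k * (1 + σ⁻¹) * Λ ^ (m - 1) * ε ^ (1 - κ) with hc₀
  have hpt : ∀ t : ℝ, ‖A (σ + t * I) * (exp ((σ + t * I) * v) * smoothKernel η k (σ + t * I))‖ ≤
      c₀ * (betaFun κ p (ε * (1 + t)) + betaFun κ p (ε * (1 - t))) := by
    intro t
    set s : ℂ := σ + t * I with hs
    have hre : s.re = σ := by simp [hs]
    have him : s.im = t := by simp [hs]
    have hs0 : 0 < ‖s‖ := by have := re_le_norm s; linarith
    have h1 := h.growth s hre
    have h2 := norm_expAvg_le_inv hη hη0 hσ hre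
    rw [him] at h1 h2
    have h3 := one_add_abs_im_le_mul_norm hσ hre.ge
    rw [him] at h3
    set u := 1 + |t| with hu
    have hu0 : 0 < u := by positivity
    set q := 1 + ε * u with hq
    have hq0 : 0 < q := by positivity
    have hl0 : 0 ≤ Real.log (3 + |t|) := Real.log_nonneg (by linarith [abs_nonneg t])
    have hinv : ‖s‖⁻¹ ≤ (1 + σ⁻¹) * u⁻¹ := by
      rw [← div_eq_mul_inv, le_div_iff₀ hu0, inv_mul_le_iff₀ hs0]
      linarith
    rw [norm_mul, norm_mul, norm_exp_line, smoothKernel, norm_div, norm_pow, div_eq_mul_inv]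
    calc ‖A s‖ * (Real.exp (σ * v) * (‖expAvg η s‖ ^ k * ‖s‖⁻¹))
        ≤ (C * u ^ κ * (Λ * q) ^ (m - 1)) *
          (Real.exp (σ * v) * ((D * q⁻¹) ^ k * ((1 + σ⁻¹) * u⁻¹))) := by
          gcongr
          refine h1.trans ?_
          gcongr
          exact log_three_add_le hε0 (abs_nonneg t)
      _ = C * Real.exp (σ * v) * D ^ k * (1 + σ⁻¹) * Λ ^ (m - 1) *
          (u ^ (κ - 1) * (q ^ p)⁻¹) := by
          have hkp : k = p + (m - 1) := by omega
          have h5 : u ^ (κ - 1) = u ^ κ * u⁻¹ := by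
            rw [Real.rpow_sub hu0, Real.rpow_one, div_eq_mul_inv]
          have h6 : (q⁻¹) ^ k * q ^ (m - 1) = (q ^ p)⁻¹ := by
            rw [hkp, pow_add, inv_pow, inv_pow, mul_assoc, inv_mul_cancel₀ (by positivity), mul_one]
          rw [h5, ← h6, mul_pow, mul_pow]
          ring
      _ ≤ C * Real.exp (σ * v) * D ^ k * (1 + σ⁻¹) * Λ ^ (m - 1) *
          (ε ^ (1 - κ) * (betaFun κ p (ε * (1 + t)) + betaFun κ p (ε * (1 - t)))) := by
          exact mul_le_mul_of_nonneg_left (rpow_mul_inv_le_betaFun p hε0 t) (by positivity)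
      _ = _ := by rw [hc₀]; ring
  refine (norm_integral_le_of_norm_le ((integrable_betaFun_comp hκ hp hε0).const_mul c₀)
    (Eventually.of_forall hpt)).trans (le_of_eq ?_)
  rw [integral_const_mul, integral_betaFun_comp hκ hp hε0, hc₀, lineConst]
  -- The scaling gives `ε ^ (1 - κ)` and the change of variables gives `ε⁻¹`.
  have h7 : ε ^ (-κ) = ε ^ (1 - κ) * ε⁻¹ := by
    rw [← Real.rpow_neg_one ε, ← Real.rpow_add hε0]; congr 1; ring
  rw [h7]
  ring

end StrongHypothesis

end LeftLine

/-! ### Residue comparison, choice of parameters and sandwich -/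

section Tauberian

open MeasureTheory Complex Set

lemma norm_pow_sub_one_le {z : ℂ} {E : ℝ} (hE : 1 ≤ E) (hz : ‖z‖ ≤ E) (k : ℕ) :
    ‖z ^ k - 1‖ ≤ k * E ^ k * ‖z - 1‖ := by
  rw [← geom_sum_mul, norm_mul]
  gcongr
  refine (norm_sum_le _ _).trans ?_
  calc ∑ i ∈ Finset.range k, ‖z ^ i‖ ≤ ∑ i ∈ Finset.range k, E ^ k := by
        refine Finset.sum_le_sum fun i hi => ?_
        rw [norm_pow]
        calc ‖z‖ ^ i ≤ E ^ i := by gcongr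
          _ ≤ E ^ k := pow_le_pow_right₀ hE (Finset.mem_range.1 hi).le
    _ = _ := by simp

/-- The constant in the bound for the effect of smoothing on the residue. -/
noncomputable def residueConst (α δ κ : ℝ) (m k : ℕ) : ℝ :=
  growthConst α δ κ m * (α + 1) ^ growthExponent κ m *
    (k * Real.exp (α + 1) ^ k * ((α + 1) * Real.exp (α + 1))) * (α - δ)⁻¹

lemma growthConst_nonneg {α δ : ℝ} (hα : 0 < α) (hδα : δ < α) (κ : ℝ) (m : ℕ) :
    0 ≤ growthConst α δ κ m := by
  have : 0 < α - δ := by linarith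
  unfold growthConst
  positivity

lemma lineConst_nonneg {σ : ℝ} (hσ : 0 < σ) (κ : ℝ) (m k : ℕ) : 0 ≤ lineConst σ κ m k := by
  have := betaConst_nonneg κ (k - (m - 1))
  unfold lineConst
  positivity

lemma residueConst_nonneg {α δ : ℝ} (hα : 0 < α) (hδα : δ < α) (κ : ℝ) (m k : ℕ) :
    0 ≤ residueConst α δ κ m k := by
  have : 0 < α - δ := by linarith
  have := growthConst_nonneg hα hδα κ m
  unfold residueConst
  positivity

namespace StrongHypothesis

variable {α δ κ C : ℝ} {m : ℕ} {a l : ℕ → ℝ} {A G : ℂ → ℂ}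

/-- Both terms are integrals over one circle, whose integrands differ by the factor `expAvg η z ^ k
- 1 = O(|η|)`. The bound for `G` depends on the series only through `C`. -/
lemma norm_circleIntegral_sub_residue_le (h : StrongHypothesis α δ κ m C a l A) (hα : 0 < α)
    (hδ : 0 < δ) (hδα : δ < α) (hC : 0 ≤ C) (hG : AnalyticOnNhd ℂ G {s | α - δ ≤ s.re})
    (hGA : ∀ s ≠ (α : ℂ), G s = (s - α) ^ m * A s) {η : ℝ} (hη : |η| ≤ 1) {x : ℝ} (hx : 1 ≤ x)
    {r : ℝ} (hr : 0 < r) (hrδ : r ≤ δ) (hr1 : r ≤ 1) (k : ℕ) :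
    ‖(2 * (Real.pi : ℂ) * I)⁻¹ *
        (∮ z in C(α, r), G z * (exp (z * Real.log x) * smoothKernel η k z) * ((z - α) ^ m)⁻¹)
      - residue (fun s => A s * ((x : ℂ) ^ s / s)) α‖
      ≤ r * (C * residueConst α δ κ m k * |η| * Real.exp ((α + r) * Real.log x) * (r ^ m)⁻¹) := by
  have hσ : 0 < α - δ := by linarith
  have hx0 : 0 < x := by linarith
  have hx0' : (x : ℂ) ≠ 0 := by exact_mod_cast hx0.ne'
  have hv : 0 ≤ Real.log x := Real.log_nonneg hx
  have hre : ∀ z : ℂ, ‖z - α‖ ≤ r → α - r ≤ z.re ∧ z.re ≤ α + r := fun z hz => by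
    have := (abs_re_le_norm (z - α)).trans hz
    rw [sub_re, ofReal_re, abs_le] at this
    constructor <;> linarith [this.1, this.2]
  have hz0 : ∀ z : ℂ, α - δ ≤ z.re → z ≠ 0 := fun z hz hh => by
    rw [hh, zero_re] at hz; linarith
  have hres : residue (fun s => A s * ((x : ℂ) ^ s / s)) α = (2 * (Real.pi : ℂ) * I)⁻¹ *
      ∮ z in C(α, r), G z * (exp (z * Real.log x) * z⁻¹) * ((z - α) ^ m)⁻¹ := by
    rw [residue_eq_circleIntegral hr]
    · congr 1
      refine circleIntegral.integral_congr hr.le fun z hz => ?_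
      rw [mem_sphere_iff_norm] at hz
      have hzα : z - α ≠ 0 := norm_pos_iff.1 (hz ▸ hr)
      rw [hGA z (sub_ne_zero.1 hzα), cpow_def_of_ne_zero hx0', ofReal_log hx0.le, mul_comm z]
      have : (z - α) ^ m ≠ 0 := pow_ne_zero _ hzα
      field_simp
    · intro z hzα hz
      have h1 : α - δ ≤ z.re := by linarith [(hre z hz).1]
      exact (h.analytic z ⟨h1, hzα⟩).differentiableAt.mul
        (DifferentiableAt.div (differentiableAt_id.const_cpow (Or.inl hx0')) differentiableAt_id
          (hz0 z h1))
  have hsph : ∀ z ∈ Metric.sphere (α : ℂ) r, α - δ ≤ z.re ∧ z - α ≠ 0 := fun z hz => by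
    rw [mem_sphere_iff_norm] at hz
    exact ⟨by linarith [(hre z hz.le).1], norm_pos_iff.1 (hz ▸ hr)⟩
  have hi : ∀ f : ℂ → ℂ, ContinuousOn f (Metric.sphere (α : ℂ) r) →
      CircleIntegrable (fun z => G z * (exp (z * Real.log x) * f z) * ((z - α) ^ m)⁻¹) α r := by
    intro f hf
    refine ContinuousOn.circleIntegrable hr.le (ContinuousOn.mul (ContinuousOn.mul ?_
      (ContinuousOn.mul (by fun_prop) hf)) (ContinuousOn.inv₀ (by fun_prop)
        fun z hz => pow_ne_zero _ (hsph z hz).2))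
    exact hG.continuousOn.mono fun z hz => (hsph z hz).1
  rw [hres, ← mul_sub, ← circleIntegral.integral_sub]
  · rw [← smul_eq_mul]
    refine circleIntegral.norm_two_pi_i_inv_smul_integral_le_of_norm_le_const hr.le fun z hz => ?_
    have hzs := hsph z hz
    rw [mem_sphere_iff_norm] at hz
    have hzn : ‖z‖ ≤ α + 1 := by
      calc ‖z‖ = ‖(z - α) + α‖ := by rw [sub_add_cancel]
        _ ≤ ‖z - α‖ + ‖(α : ℂ)‖ := norm_add_le _ _
        _ ≤ _ := by rw [hz, norm_real, Real.norm_of_nonneg hα.le]; linarith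
    have hzl : α - δ ≤ ‖z‖ := hzs.1.trans (re_le_norm z)
    have hzre := (re_le_norm z).trans hzn
    have h1 := h.norm_le_growthConst_mul hα hδ hδα hC hG hGA hzs.1
    have h2 := norm_pow_sub_one_le (Real.one_le_exp (by linarith : 0 ≤ α + 1))
      (norm_expAvg_le hη (hσ.le.trans hzs.1) hzre) k
    have h3 := norm_expAvg_sub_one_le hη hzn
    have h4 : ‖exp (z * Real.log x)‖ ≤ Real.exp ((α + r) * Real.log x) := by
      rw [norm_exp, re_mul_ofReal, Real.exp_le_exp]
      gcongr
      exact (hre z hz.le).2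
    have hgc := growthConst_nonneg hα hδα κ m
    have hsplit : G z * (exp (z * Real.log x) * smoothKernel η k z) * ((z - α) ^ m)⁻¹ -
        G z * (exp (z * Real.log x) * z⁻¹) * ((z - α) ^ m)⁻¹ =
        G z * exp (z * Real.log x) * (expAvg η z ^ k - 1) * z⁻¹ * ((z - α) ^ m)⁻¹ := by
      rw [smoothKernel, div_eq_mul_inv]; ring
    rw [hsplit, norm_mul, norm_mul, norm_mul, norm_mul, norm_inv, norm_inv, norm_pow, hz]
    calc _ ≤ (C * growthConst α δ κ m * (α + 1) ^ growthExponent κ m) *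
          Real.exp ((α + r) * Real.log x) * (k * Real.exp (α + 1) ^ k *
            (|η| * ((α + 1) * Real.exp (α + 1)))) * (α - δ)⁻¹ * (r ^ m)⁻¹ := by
          gcongr
          · exact h1.trans (by gcongr)
          · exact h2.trans (by gcongr)
      _ = _ := by rw [residueConst]; ring
  · refine hi _ fun z hz => ?_
    exact (differentiableAt_smoothKernel η k (hz0 z (hsph z hz).1)).continuousAt.continuousWithinAt
  · exact hi _ (continuousOn_id.inv₀ fun z hz => hz0 z (hsph z hz).1)

lemma log_three_add_rpow_le {x d : ℝ} (hx : 2 ≤ x) (hd : 0 ≤ d) :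
    Real.log (3 + x ^ d) ≤ (2 + d) * Real.log x := by
  have hx0 : 0 < x := by linarith
  have h1 : 1 ≤ x ^ d := Real.one_le_rpow (by linarith) hd
  have h2 : (4 : ℝ) ≤ x ^ 2 := by nlinarith
  calc Real.log (3 + x ^ d) ≤ Real.log (x ^ 2 * x ^ d) :=
        Real.log_le_log (by positivity) (by nlinarith)
    _ = _ := by
      rw [Real.log_mul (by positivity) (by positivity), Real.log_pow, Real.log_rpow hx0]
      push_cast; ring

/-- The main estimate for smoothed partial sums. -/
lemma exists_smoothed_bound (hα : 0 < α) (hδ : 0 < δ) (hδα : δ < α) (hκ : 0 < κ) (hm : 1 ≤ m)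
    (hC : 0 ≤ C) : ∃ K : ℝ, 0 ≤ K ∧ ∀ (a l : ℕ → ℝ) (A : ℂ → ℂ),
      StrongHypothesis α δ κ m C a l A → ∀ x η : ℝ, 2 ≤ x → |η| = x ^ (-(δ / (κ + 1))) →
      ∃ W : ℝ, HasSum (fun n => a n *
          smoothStep η (growthExponent κ m + 1) (Real.log x - Real.log (l n))) W ∧
        ‖(W : ℂ) - residue (fun s => A s * ((x : ℂ) ^ s / s)) α‖
          ≤ K * (x ^ (α - δ / (κ + 1)) * Real.log x ^ (m - 1)) := by
  set k := growthExponent κ m + 1 with hk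
  set d := δ / (κ + 1) with hd
  have hd0 : 0 < d := by positivity
  have hdκ : d * (κ + 1) = δ := by rw [hd]; field_simp
  have hσ : 0 < α - δ := by linarith
  -- The radius will be `c₀ / log x`. For `x ≥ 2` it is then at most `min δ 1`, and `c₀ ≤ 1` keeps
  -- `x ^ r ≤ e`.
  set c₀ := min δ 1 * Real.log 2 with hc₀
  have hlog2 : 0 < Real.log 2 := Real.log_pos one_lt_two
  have hlog2' : Real.log 2 ≤ 1 := by have := Real.log_two_lt_d9; linarith
  have hmin : 0 < min δ 1 := lt_min hδ one_pos
  have hc₀0 : 0 < c₀ := by positivity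
  have hc₀1 : c₀ ≤ 1 := by
    calc c₀ ≤ 1 * 1 := mul_le_mul (min_le_right _ _) hlog2' hlog2.le zero_le_one
      _ = 1 := one_mul 1
  have hR0 := residueConst_nonneg hα hδα κ m k
  have hL0 := lineConst_nonneg hσ κ m k
  refine ⟨C * residueConst α δ κ m k * Real.exp 1 * (c₀ ^ (m - 1))⁻¹ +
    C * lineConst (α - δ) κ m k * (2 + d) ^ (m - 1), by positivity,
    fun a l A h x η hx hηx => ?_⟩
  have hx0 : 0 < x := by linarith
  have hx1 : 1 ≤ x := by linarith
  have hv : Real.log 2 ≤ Real.log x := Real.log_le_log two_pos hx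
  have hv0 : 0 < Real.log x := hlog2.trans_le hv
  have hη0 : η ≠ 0 := abs_pos.1 (hηx ▸ Real.rpow_pos_of_pos hx0 _)
  have hη1 : |η| ≤ 1 := hηx ▸ Real.rpow_le_one_of_one_le_of_nonpos hx1 (by linarith)
  obtain ⟨G, hG, hGA⟩ := h.exists_analytic
  set r := c₀ / Real.log x with hr
  have hr0 : 0 < r := by positivity
  have hrmin : r ≤ min δ 1 := by
    rw [hr, div_le_iff₀ hv0, hc₀]; gcongr
  have hrδ := hrmin.trans (min_le_left _ _)
  have hr1 := hrmin.trans (min_le_right _ _)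
  have hsum := h.hasSum_smoothStep hα hδ hη1 hη0 (growthExponent κ m) (Real.log x)
    (c := α + 1) (by linarith)
  rw [h.integral_line_eq hα hδ hδα hC hG hGA hη1 hη0 (Real.log x) hr0 hrδ hr1 rfl] at hsum
  have hsumm := Complex.summable_ofReal.1 hsum.summable
  have hW := hsum.unique (by exact_mod_cast hsumm.hasSum : HasSum _ ((∑' n, a n *
    smoothStep η k (Real.log x - Real.log (l n)) : ℝ) : ℂ))
  refine ⟨_, hsumm.hasSum, ?_⟩
  rw [← hW, add_sub_right_comm]
  refine (norm_add_le _ _).trans ?_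
  rw [add_mul]
  refine add_le_add ?_ ?_
  · refine (h.norm_circleIntegral_sub_residue_le hα hδ hδα hC hG hGA hη1 hx1 hr0 hrδ hr1 k).trans ?_
    have h1 : Real.exp ((α + r) * Real.log x) ≤ x ^ α * Real.exp 1 := by
      have : r * Real.log x = c₀ := by rw [hr]; field_simp
      rw [Real.rpow_def_of_pos hx0, ← Real.exp_add, Real.exp_le_exp, add_mul, this]
      linarith
    -- The length of the circle cancels one power of the pole, which leaves exactly `m - 1`
    -- logarithms.
    have h2 : r * (r ^ m)⁻¹ = (c₀ ^ (m - 1))⁻¹ * Real.log x ^ (m - 1) := by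
      obtain ⟨n, rfl⟩ : ∃ n, m = n + 1 := ⟨m - 1, by omega⟩
      rw [Nat.add_sub_cancel, pow_succ, mul_inv, mul_comm, mul_assoc, inv_mul_cancel₀ hr0.ne',
        mul_one, hr, div_pow, inv_div, div_eq_mul_inv, mul_comm]
    have h3 : x ^ (α - d) = x ^ α * |η| := by
      rw [hηx, ← Real.rpow_add hx0, ← sub_eq_add_neg]
    calc _ = C * residueConst α δ κ m k * |η| * Real.exp ((α + r) * Real.log x) *
          (r * (r ^ m)⁻¹) := by ring
      _ ≤ C * residueConst α δ κ m k * |η| * (x ^ α * Real.exp 1) *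
          ((c₀ ^ (m - 1))⁻¹ * Real.log x ^ (m - 1)) := by rw [h2]; gcongr
      _ = _ := by rw [h3]; ring
  · have hp : κ < (k - (m - 1) : ℕ) := by
      have h1 : ⌈κ⌉₊ + 1 ≤ k - (m - 1) := by rw [hk, growthExponent]; omega
      calc κ ≤ ⌈κ⌉₊ := Nat.le_ceil κ
        _ < ((⌈κ⌉₊ + 1 : ℕ) : ℝ) := by push_cast; linarith
        _ ≤ _ := by exact_mod_cast h1
    have h1 := h.norm_integral_left_line_le hδα hκ hC hη1 hη0 (Real.log x) (k := k)
      (by rw [hk, growthExponent]; omega) hp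
    have hpi : ‖(1 / (2 * Real.pi) : ℂ)‖ ≤ 1 := by
      have h2 : (1 / (2 * Real.pi) : ℂ) = ((1 / (2 * Real.pi) : ℝ) : ℂ) := by push_cast; rfl
      rw [h2, norm_real, Real.norm_of_nonneg (by positivity), div_le_one (by positivity)]
      linarith [Real.pi_gt_three]
    have h2 : Real.log (3 + |η|⁻¹) ≤ (2 + d) * Real.log x := by
      rw [hηx, ← Real.rpow_neg hx0.le, neg_neg]
      exact log_three_add_rpow_le hx hd0.le
    have h2' : 0 ≤ Real.log (3 + |η|⁻¹) :=
      Real.log_nonneg (by have := inv_pos.2 (abs_pos.2 hη0); linarith)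
    -- The two errors balance here: `α - δ + d κ = α - d` because `d (κ + 1) = δ`.
    have h3 : Real.exp ((α - δ) * Real.log x) * |η| ^ (-κ) = x ^ (α - d) := by
      rw [hηx, ← Real.rpow_mul hx0.le, mul_comm _ (Real.log x), ← Real.rpow_def_of_pos hx0,
        ← Real.rpow_add hx0]
      congr 1
      linear_combination hdκ
    rw [norm_mul]
    calc _ ≤ 1 * (C * lineConst (α - δ) κ m k * Real.exp ((α - δ) * Real.log x) *
          (|η| ^ (-κ) * Real.log (3 + |η|⁻¹) ^ (m - 1))) := by gcongr
      _ = C * lineConst (α - δ) κ m k * x ^ (α - d) * Real.log (3 + |η|⁻¹) ^ (m - 1) := by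
          rw [← h3]; ring
      _ ≤ C * lineConst (α - δ) κ m k * x ^ (α - d) * ((2 + d) * Real.log x) ^ (m - 1) := by
          gcongr
      _ = _ := by rw [mul_pow]; ring

end StrongHypothesis

lemma IsDirichletData.hasSum_partialSum {a l : ℕ → ℝ} (h : IsDirichletData a l) (x : ℝ) :
    HasSum ({n : ℕ | l n ≤ x}.indicator a) (partialSum a l x) := by
  have hfin : {n : ℕ | l n ≤ x}.Finite := by
    obtain ⟨N, hN⟩ := eventually_atTop.1 (h.tendsto_atTop.eventually_gt_atTop x)
    refine (finite_lt_nat N).subset fun n hn => ?_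
    by_contra hh
    exact absurd (hN n (not_lt.1 hh)) (not_lt.2 hn)
  rw [partialSum, finsum_mem_eq_finite_toFinset_sum _ hfin]
  have := hasSum_sum_of_ne_finset_zero (L := .unconditional ℕ) (f := {n : ℕ | l n ≤ x}.indicator a)
    (s := hfin.toFinset) fun n hn => indicator_of_notMem (by simpa using hn) _
  convert this using 1
  refine Finset.sum_congr rfl fun n hn => ?_
  rw [indicator_of_mem (by simpa using hn)]

end Tauberian

theorem mainTheorem4 (α δ κ : ℝ) (m : ℕ) (C : ℝ)
    (hα : 0 < α) (hδ : 0 < δ) (hδα : δ < α) (hκ : 0 < κ) (hm : 1 ≤ m) (hC : 1 ≤ C) :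
    ∃ K : ℝ, ∀ (a l : ℕ → ℝ) (A : ℂ → ℂ), StrongHypothesis α δ κ m C a l A →
      ∀ x : ℝ, 2 ≤ x →
        ‖(partialSum a l x : ℂ) - residue (fun s => A s * ((x : ℂ) ^ s / s)) (α : ℂ)‖
          ≤ K * (x ^ (α - δ / (κ + 1)) * Real.log x ^ (m - 1)) := by
  obtain ⟨K, -, hK⟩ := StrongHypothesis.exists_smoothed_bound hα hδ hδα hκ hm
    (zero_le_one.trans hC)
  refine ⟨3 * K, fun a l A h x hx => ?_⟩
  have hx0 : 0 < x := by linarith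
  set ε := x ^ (-(δ / (κ + 1))) with hε
  have hε0 : 0 < ε := Real.rpow_pos_of_pos hx0 _
  -- Positive `η` gives the upper smoothed sum and negative `η` the lower one.
  obtain ⟨W₁, hW₁, hb₁⟩ := hK a l A h x ε hx (abs_of_pos hε0)
  obtain ⟨W₂, hW₂, hb₂⟩ := hK a l A h x (-ε) hx (by rw [abs_neg, abs_of_pos hε0])
  have hS := h.data.hasSum_partialSum x
  have hl : ∀ n, 0 < l n := fun n => zero_lt_one.trans_le (h.data.one_le_apply n)
  have hle₁ : partialSum a l x ≤ W₁ := by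
    refine hasSum_le (fun n => ?_) hS hW₁
    by_cases hn : l n ≤ x
    · rw [Set.indicator_of_mem (by exact hn), smoothStep_eq_one hε0.le _
        (sub_nonneg.2 (Real.log_le_log (hl n) hn)), mul_one]
    · rw [Set.indicator_of_notMem (by exact hn)]
      exact mul_nonneg (h.data.coeff_nonneg n) (smoothStep_mem_Icc _ _ _).1
  have hle₂ : W₂ ≤ partialSum a l x := by
    refine hasSum_le (fun n => ?_) hW₂ hS
    by_cases hn : l n ≤ x
    · rw [Set.indicator_of_mem (by exact hn)]
      exact mul_le_of_le_one_right (h.data.coeff_nonneg n) (smoothStep_mem_Icc _ _ _).2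
    · rw [Set.indicator_of_notMem (by exact hn), smoothStep_eq_zero (neg_nonpos.2 hε0.le) _
        (sub_neg.2 (Real.log_lt_log hx0 (not_le.1 hn))), mul_zero]
  set R := residue (fun s => A s * ((x : ℂ) ^ s / s)) (α : ℂ) with hR
  set E := K * (x ^ (α - δ / (κ + 1)) * Real.log x ^ (m - 1)) with hE
  -- The residue is a complex number, so it cannot be placed between the real sums. The partial sum
  -- is instead compared with `W₂` through `W₁ - W₂`, which produces three errors and the constant
  -- `3 * K`.
  have h1 : ‖((partialSum a l x - W₂ : ℝ) : ℂ)‖ ≤ ‖((W₁ - W₂ : ℝ) : ℂ)‖ := by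
    rw [Complex.norm_real, Complex.norm_real, Real.norm_of_nonneg (by linarith),
      Real.norm_of_nonneg (by linarith)]
    linarith
  have h2 : ‖((W₁ - W₂ : ℝ) : ℂ)‖ ≤ ‖(W₁ : ℂ) - R‖ + ‖(W₂ : ℂ) - R‖ := by
    have : ((W₁ - W₂ : ℝ) : ℂ) = (W₁ - R) - (W₂ - R) := by push_cast; ring
    rw [this]
    exact norm_sub_le _ _
  have h3 : (partialSum a l x : ℂ) - R = ((partialSum a l x - W₂ : ℝ) : ℂ) + (W₂ - R) := by
    push_cast; ring
  calc ‖(partialSum a l x : ℂ) - R‖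
      ≤ ‖((partialSum a l x - W₂ : ℝ) : ℂ)‖ + ‖(W₂ : ℂ) - R‖ := by
        rw [h3]; exact norm_add_le _ _
    _ ≤ E + E + E := by linarith
    _ = 3 * K * (x ^ (α - δ / (κ + 1)) * Real.log x ^ (m - 1)) := by rw [hE]; ring
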